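/- **Theorem.** Existential monadic second order (EMSO) sentences about graphs are sentences of the form $\exists X_1\ldots\exists X_m\,\phi(X_1,\ldots,X_m)$, where $X_1,\dots,X_m$ (the monadic variables) range over sets of vertices and $\phi$ is a first order sentence in adjacency $\sim$, equality $=$ and the unary predicates $X_1,\ldots,X_m$. For a positive integer $a$ let $F_1$ be the simple path on $a$ vertices rooted at an end-point, let $F_2$ be the perfect $4$-ary tree with $a$ levels (the root, on level $0$; every vertex on levels $0,\dots,a-2$ has exactly $4$ children; $\frac{4^a-1}{3}$ vertices in total), and let $W_a$ be the graph obtained from the disjoint union of $F_1$ and $F_2$ by adding all edges $\{u,v\}$ with $u\in V(F_1)$, $v\in V(F_2)$ such that $u$ and $v$ are at the same distance from the roots of $F_1$ and $F_2$ respectively. Let $p\in(0,1)$ be a constant, and let $G(n,p)$ be the binomial random graph on $n$ vertices. 1. There is an EMSO sentence $\varphi_1=\exists X\,\phi(X)$ with only one monadic variable (and any number of first order variables) such that a finite non-empty graph $G$ satisfies $\varphi_1$ if and only if, for some positive integer $a$, there is an induced copy $F$ of $W_a$ in $G$ such that every vertex of $G$ outside $F$ has a neighbour in $F$; and the probability ${\sf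 P}(G(n,p)\models\varphi_1)$ does not converge as $n\to\infty$. 2. There is an EMSO sentence $\varphi_2$ with only three first order variables (each of which may be quantified repeatedly, and with any number of monadic variables) such that the probability ${\sf P}(G(n,p)\models\varphi_2)$ does not converge as $n\to\infty$. -/

import Mathlib

namespace EMSOGraph

/-- First-order formulas in the language of graphs (adjacency and equality) expanded by the unary
predicates (monadic variables) `X 0, …, X (m - 1)`, written with the `k` named first-order
variables `x 0, …, x (k - 1)`. A variable may be quantified repeatedly, so formulas over `k` names
are exactly the first-order formulas with (at most) `k` first-order variables. -/
inductive FOFormula (m k : ℕ) : Type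
  | adj (x y : Fin k) : FOFormula m k
  | eq (x y : Fin k) : FOFormula m k
  | mem (X : Fin m) (x : Fin k) : FOFormula m k
  | neg (φ : FOFormula m k) : FOFormula m k
  | and (φ ψ : FOFormula m k) : FOFormula m k
  | or (φ ψ : FOFormula m k) : FOFormula m k
  | imp (φ ψ : FOFormula m k) : FOFormula m k
  | iff (φ ψ : FOFormula m k) : FOFormula m k
  | all (x : Fin k) (φ : FOFormula m k) : FOFormula m k
  | ex (x : Fin k) (φ : FOFormula m k) : FOFormula m k

namespace FOFormula

variable {m k : ℕ}

/-- The first-order variables that occur free in a formula. -/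
def freeVars : FOFormula m k → Finset (Fin k)
  | adj x y => {x, y}
  | eq x y => {x, y}
  | mem _ x => {x}
  | neg φ => φ.freeVars
  | and φ ψ => φ.freeVars ∪ ψ.freeVars
  | or φ ψ => φ.freeVars ∪ ψ.freeVars
  | imp φ ψ => φ.freeVars ∪ ψ.freeVars
  | iff φ ψ => φ.freeVars ∪ ψ.freeVars
  | all x φ => φ.freeVars.erase x
  | ex x φ => φ.freeVars.erase x

/-- Satisfaction in the graph `G`, the monadic variables being interpreted by the vertex sets `S`
and the first-order variables by the vertices `v`. -/
def Realize {V : Type*} (G : SimpleGraph V) (S : Fin m → Set V) :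
    FOFormula m k → (Fin k → V) → Prop
  | adj x y, v => G.Adj (v x) (v y)
  | eq x y, v => v x = v y
  | mem X x, v => v x ∈ S X
  | neg φ, v => ¬ φ.Realize G S v
  | and φ ψ, v => φ.Realize G S v ∧ ψ.Realize G S v
  | or φ ψ, v => φ.Realize G S v ∨ ψ.Realize G S v
  | imp φ ψ, v => φ.Realize G S v → ψ.Realize G S v
  | iff φ ψ, v => (φ.Realize G S v ↔ ψ.Realize G S v)
  | all x φ, v => ∀ a : V, φ.Realize G S (Function.update v x a)
  | ex x φ, v => ∃ a : V, φ.Realize G S (Function.update v x a)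

end FOFormula

/-- An existential monadic second-order sentence `∃ X₁ … ∃ Xₘ φ(X₁, …, Xₘ)` with `m` monadic
variables, whose first-order part `φ` is a sentence written with `k` first-order variables. -/
structure EMSOSentence (m k : ℕ) where
  /-- The first-order part. -/
  body : FOFormula m k
  /-- The first-order part has no free first-order variables. -/
  closed : body.freeVars = ∅

/-- `G ⊨ ∃ X₁ … ∃ Xₘ φ(X₁, …, Xₘ)`. Structures are non-empty, as usual in model theory; since `φ` is
closed, its truth value on a non-empty vertex set does not depend on the assignment `v`. -/
def EMSOSentence.Models {m k : ℕ} {V : Type*} (G : SimpleGraph V) (φ : EMSOSentence m k) : Prop :=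
  ∃ S : Fin m → Set V, ∀ v : Fin k → V, φ.body.Realize G S v

/-- The product `F₁ · F₂` of graphs rooted at `r₁`, `r₂`: the disjoint union of `F₁` and `F₂`
together with all edges between a vertex of `F₁` and a vertex of `F₂` that are at the same distance
from the respective roots. -/
def rootedProduct {V₁ V₂ : Type*} (F₁ : SimpleGraph V₁) (r₁ : V₁) (F₂ : SimpleGraph V₂) (r₂ : V₂) :
    SimpleGraph (V₁ ⊕ V₂) where
  Adj
    | .inl u, .inl v => F₁.Adj u v
    | .inr u, .inr v => F₂.Adj u v
    | .inl u, .inr v => F₁.dist r₁ u = F₂.dist r₂ v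
    | .inr v, .inl u => F₁.dist r₁ u = F₂.dist r₂ v
  symm := ⟨by
    rintro (u | u) (v | v) h
    · exact F₁.adj_symm h
    · exact h
    · exact h
    · exact F₂.adj_symm h⟩
  loopless := ⟨by
    rintro (u | u) h
    · exact F₁.irrefl h
    · exact F₂.irrefl h⟩

/-- The perfect 4-ary tree with `a` levels. Its vertices are the words of length less than `a` over
a 4-letter alphabet; the children of a word `w` are the words `c :: w`. -/
def perfectTree (a : ℕ) : SimpleGraph {w : List (Fin 4) // w.length < a} where
  Adj u v := (∃ c : Fin 4, v.1 = c :: u.1) ∨ (∃ c : Fin 4, u.1 = c :: v.1)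
  symm := ⟨fun _ _ h => h.symm⟩
  loopless := ⟨by
    rintro u (⟨c, h⟩ | ⟨c, h⟩) <;> simpa using congrArg List.length h⟩

/-- The graph `W_a`: the product of the simple path on `a` vertices, rooted at an end-point, and the
perfect 4-ary tree with `a` levels, rooted at the empty word. -/
def graphW (a : ℕ+) :
    SimpleGraph (Fin (a : ℕ) ⊕ {w : List (Fin 4) // w.length < (a : ℕ)}) :=
  rootedProduct (SimpleGraph.pathGraph (a : ℕ)) ⟨0, a.pos⟩ (perfectTree (a : ℕ)) ⟨[], a.pos⟩

/-- `G` has an induced copy of `H` such that every vertex of `G` outside the copy has a neighbour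
in the copy. -/
def HasInducedDominatingCopy {U V : Type*} (H : SimpleGraph U) (G : SimpleGraph V) : Prop :=
  ∃ f : H ↪g G, ∀ v ∉ Set.range f, ∃ u : U, G.Adj v (f u)

/-- The probability that the binomial random graph `G(n, p)` satisfies `φ`. -/
noncomputable def prob {m k : ℕ} (φ : EMSOSentence m k) (p : unitInterval) (n : ℕ) : ℝ :=
  (SimpleGraph.binomialRandom (Fin n) p).real {G | φ.Models G}

/-- The real sequence `u` converges to a (finite) limit. -/
def Converges (u : ℕ → ℝ) : Prop :=
  ∃ L : ℝ, Filter.Tendsto u Filter.atTop (nhds L)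

end EMSOGraph

namespace EMSOGraph

/-! ### Distances from the root and adjacency in `graphW` -/

/-! Write `q = 1 - p` and let `N` be the order of `W_a`. The graph `W_a` is sparse: its edges can be
oriented with out-degrees at most two, so every vertex set `I` spans at most `2|I|` edges. Hence the
expected number of induced copies in `G(n, p)` is `n ^ N * q ^ (N ^ 2 / 2)` up to a factor
exponential in `N`, and copies appear once `n` passes about `q ^ (-N / 2)`. A set of `N` vertices
dominates the graph only while `n * q ^ N` is small, that is, for `n` below about `q ^ (-N)`. So
`W_a` has a window of good `n` between these two bounds. The order more than doubles from `W_a` to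
`W_(a+1)`, so consecutive windows leave gaps, and the probability of a dominating copy of some `W_a`
oscillates.

With `q = s ^ 6` the window is roughly from `s ^ (-3N)` to `s ^ (-6N)`. At `n ≈ s ^ (-4N)` the
second moment method gives probability tending to one (`le_dominatingCopyProb`). At `n ≈ s ^ (-8N)`
no set of at most `N` vertices dominates. Every `W_b` with `b > a` contains `W_(a+1)`, whose order
is at least `3N` and whose expected number of copies tends to zero (`dominatingCopyProb_le`). A
limit would be at least one and at most zero (`not_converges_dominatingCopyProb`).

It remains to define dominating copies by EMSO sentences. The local conditions of `IsLayering`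
describe a path `P` and a tree `T` whose levels are the neighbourhoods of the path vertices.
First-order conditions alone cannot exclude extra cycles in `P`, but the tree does: a level has four
times as many tree vertices as the preceding one, so in a finite graph following predecessors must
end at the root, and a path vertex is determined by the size of its level. This yields
`IsLayering.exists_embedding`.

With one set `X = P ∪ T`, path vertices are recognised by degree: a tree vertex has at most six
neighbours in `X`, a path vertex beyond the first two has at least sixteen, and the first two are
named by first-order variables. With three first-order variables, further sets mark the path modulo
three, which orients it, and number the children of each tree vertex, which replaces counting to
four. -/

theorem dist_eq_of_height {V : Type*} {G : SimpleGraph V} (h : V → ℕ) {r : V} (hr : h r = 0)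
    (h_root : ∀ v, h v = 0 → v = r) (h_adj : ∀ u v, G.Adj u v → h v ≤ h u + 1)
    (h_pred : ∀ v, h v ≠ 0 → ∃ u, G.Adj u v ∧ h v = h u + 1) (v : V) : G.dist r v = h v := by
  have key : ∀ n v, h v = n → ∃ w : G.Walk r v, w.length = n := by
    intro n
    induction n with
    | zero =>
      intro v hv
      obtain rfl := h_root v hv
      exact ⟨.nil, rfl⟩
    | succ n ih =>
      intro v hv
      obtain ⟨u, huv, hu⟩ := h_pred v (by omega)
      obtain ⟨w, hw⟩ := ih u (by omega)
      exact ⟨w.concat huv, by simp [hw]⟩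
  have lower : ∀ (u v : V) (w : G.Walk u v), h v ≤ h u + w.length := by
    intro u v w
    induction w with
    | nil => simp
    | cons huv w ih =>
      have := h_adj _ _ huv
      rw [SimpleGraph.Walk.length_cons]
      omega
  obtain ⟨w, hw⟩ := key _ v rfl
  apply le_antisymm
  · exact hw ▸ SimpleGraph.dist_le w
  · obtain ⟨w', hw'⟩ := w.reachable.exists_walk_length_eq_dist
    have := lower _ _ w'
    omega

theorem pathGraph_dist_zero {a : ℕ} (ha : 0 < a) (i : Fin a) :
    (SimpleGraph.pathGraph a).dist ⟨0, ha⟩ i = i := by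
  refine dist_eq_of_height (fun i : Fin a => (i : ℕ)) rfl (fun v hv => Fin.ext hv) ?_ ?_ i
  · intro u v huv
    rw [SimpleGraph.pathGraph_adj] at huv
    omega
  · intro v hv
    refine ⟨⟨v - 1, by omega⟩, ?_, ?_⟩
    · rw [SimpleGraph.pathGraph_adj]
      left
      dsimp only at hv ⊢
      omega
    · dsimp only at hv ⊢
      omega

theorem perfectTree_dist_nil {a : ℕ} (ha : 0 < a) (w : {w : List (Fin 4) // w.length < a}) :
    (perfectTree a).dist ⟨[], ha⟩ w = w.1.length := by
  refine dist_eq_of_height (fun w : {w : List (Fin 4) // w.length < a} => w.1.length) rfl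
    (fun v hv => Subtype.ext (List.length_eq_zero_iff.1 hv)) ?_ ?_ w
  · rintro u v (⟨c, h⟩ | ⟨c, h⟩)
    · simp [h]
    · simp only [h, List.length_cons]
      omega
  · rintro ⟨v, hv⟩ h
    cases v with
    | nil => simp at h
    | cons c v =>
      simp only [List.length_cons] at hv
      exact ⟨⟨v, by omega⟩, Or.inl ⟨c, rfl⟩, rfl⟩

section Adjacency
variable {a : ℕ+}

@[simp]
theorem graphW_adj_inl_inl {i j : Fin (a : ℕ)} :
    (graphW a).Adj (.inl i) (.inl j) ↔ (i : ℕ) + 1 = j ∨ (j : ℕ) + 1 = i :=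
  SimpleGraph.pathGraph_adj

@[simp]
theorem graphW_adj_inl_inr {i : Fin (a : ℕ)} {w : {w : List (Fin 4) // w.length < (a : ℕ)}} :
    (graphW a).Adj (.inl i) (.inr w) ↔ (i : ℕ) = w.1.length := by
  change (SimpleGraph.pathGraph (a : ℕ)).dist ⟨0, a.pos⟩ i =
    (perfectTree (a : ℕ)).dist ⟨[], a.pos⟩ w ↔ _
  rw [pathGraph_dist_zero, perfectTree_dist_nil]

@[simp]
theorem graphW_adj_inr_inl {i : Fin (a : ℕ)} {w : {w : List (Fin 4) // w.length < (a : ℕ)}} :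
    (graphW a).Adj (.inr w) (.inl i) ↔ (i : ℕ) = w.1.length := by
  rw [SimpleGraph.adj_comm, graphW_adj_inl_inr]

@[simp]
theorem graphW_adj_inr_inr {u v : {w : List (Fin 4) // w.length < (a : ℕ)}} :
    (graphW a).Adj (.inr u) (.inr v) ↔ (∃ c, v.1 = c :: u.1) ∨ ∃ c, u.1 = c :: v.1 :=
  Iff.rfl

end Adjacency

/-- The first `a` levels of `W_b` span a copy of `W_a`. -/
def graphWEmbedding {a b : ℕ+} (hab : a ≤ b) : graphW a ↪g graphW b where
  toFun := Sum.map (fun i => ⟨i, i.2.trans_le hab⟩) (fun w => ⟨w.1, w.2.trans_le hab⟩)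
  inj' := by
    rintro (⟨i, hi⟩ | ⟨w, hw⟩) (⟨j, hj⟩ | ⟨w', hw'⟩) h <;> simp_all
  map_rel_iff' := by
    rintro (i | w) (j | w')
    · rw [graphW_adj_inl_inl (a := a)]
      exact graphW_adj_inl_inl
    · rw [graphW_adj_inl_inr (a := a)]
      exact graphW_adj_inl_inr
    · rw [graphW_adj_inr_inl (a := a)]
      exact graphW_adj_inr_inl
    · rw [graphW_adj_inr_inr (a := a)]
      exact graphW_adj_inr_inr

/-- `W_a` has an orientation with out-degrees at most two: path vertices point to their predecessor,
tree vertices to their parent and to the path vertex on their level. -/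
theorem graphW_exists_orientation (a : ℕ+) :
    ∃ o : Fin 2 → (Fin (a : ℕ) ⊕ {w : List (Fin 4) // w.length < (a : ℕ)}) →
        (Fin (a : ℕ) ⊕ {w : List (Fin 4) // w.length < (a : ℕ)}),
      ∀ u v, (graphW a).Adj u v → ∃ j, v = o j u ∨ u = o j v := by
  refine ⟨fun j => Sum.elim (fun i => .inl ⟨i - 1, by omega⟩) (fun w => if j = 0 then
    .inr ⟨w.1.tail, by have := w.2; simp only [List.length_tail]; omega⟩
    else .inl ⟨w.1.length, w.2⟩), ?_⟩
  rintro (⟨i, hi⟩ | ⟨w, hw⟩) (⟨j, hj⟩ | ⟨w', hw'⟩) h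
  · simp only [graphW_adj_inl_inl] at h
    refine ⟨0, ?_⟩
    simp only [Sum.elim_inl, Sum.inl.injEq, Fin.mk.injEq]
    omega
  · simp only [graphW_adj_inl_inr] at h
    exact ⟨1, Or.inr (by simp [h])⟩
  · simp only [graphW_adj_inr_inl] at h
    exact ⟨1, Or.inl (by simp [h])⟩
  · simp only [graphW_adj_inr_inr] at h
    refine ⟨0, ?_⟩
    rcases h with ⟨c, rfl⟩ | ⟨c, rfl⟩ <;> simp

/-! ### The order of `graphW` -/

/-- A nonempty word of length at most `a` is a letter followed by a word of length less than `a`. -/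
def wordsSuccEquiv (a : ℕ) : {w : List (Fin 4) // w.length < a + 1} ≃
    Option (Fin 4 × {w : List (Fin 4) // w.length < a}) where
  toFun
    | ⟨[], _⟩ => none
    | ⟨c :: w, h⟩ => some (c, ⟨w, by simpa using h⟩)
  invFun
    | none => ⟨[], by simp⟩
    | some (c, w) => ⟨c :: w.1, by simpa using w.2⟩
  left_inv := by rintro ⟨_ | ⟨c, w⟩, h⟩ <;> rfl
  right_inv := by rintro (_ | ⟨c, w, h⟩) <;> rfl

instance finite_words (a : ℕ) : Finite {w : List (Fin 4) // w.length < a} := by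
  induction a with
  | zero => exact @Finite.of_subsingleton _ ⟨fun x => absurd x.2 (by simp)⟩
  | succ a ih => exact Finite.of_equiv _ (wordsSuccEquiv a).symm

theorem card_words_succ (a : ℕ) : Nat.card {w : List (Fin 4) // w.length < a + 1} =
    4 * Nat.card {w : List (Fin 4) // w.length < a} + 1 := by
  rw [Nat.card_congr (wordsSuccEquiv a), Finite.card_option, Nat.card_prod]
  simp

/-- The number of vertices of `W_a`. -/
noncomputable def orderW (a : ℕ) : ℕ := a + Nat.card {w : List (Fin 4) // w.length < a}

theorem card_vertices_graphW (a : ℕ) :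
    Nat.card (Fin a ⊕ {w : List (Fin 4) // w.length < a}) = orderW a := by
  simp [orderW, Nat.card_sum]

theorem two_mul_le_card_words (a : ℕ) :
    2 * a ≤ Nat.card {w : List (Fin 4) // w.length < a} + 1 := by
  induction a with
  | zero => simp
  | succ a ih =>
    rw [card_words_succ]
    rcases a with _ | a
    · simp
    · omega

/-- This growth creates the gaps between the windows. At `n ≈ s ^ (-8N)`, with `N` the order of
`W_a`, the absence of `W_(a+1)` needs an order ratio above 8/3, which the factor three provides. -/
theorem three_mul_orderW_le (a : ℕ) : 3 * orderW a ≤ orderW (a + 1) := by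
  have := two_mul_le_card_words a
  rw [orderW, orderW, card_words_succ]
  omega

theorem le_orderW (a : ℕ) : a ≤ orderW a := Nat.le_add_right _ _

theorem orderW_mono : Monotone orderW :=
  monotone_nat_of_le_succ fun a => (Nat.le_mul_of_pos_left _ (by norm_num)).trans
    (three_mul_orderW_le a)

end EMSOGraph

namespace EMSOGraph

/-! ### An axiomatic description of induced copies of `graphW` -/

/-- `s` is a child of `t`: they are adjacent vertices of `T` on consecutive levels. -/
def IsChild {V : Type*} (G : SimpleGraph V) (T : Set V) (nxt : V → V → Prop) (t s : V) : Prop :=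
  t ∈ T ∧ s ∈ T ∧ G.Adj t s ∧ ∃ u v, G.Adj u t ∧ G.Adj v s ∧ nxt u v

/-- Conditions on a set `P` (the path), its end-point `r`, the successor relation `nxt` on the path
and a set `T` (the tree), saying that `P ∪ T` induces some `W_a`, except that the number of children
is not specified. -/
structure IsPreLayering {V : Type*} (G : SimpleGraph V) (P T : Set V) (r : V)
    (nxt : V → V → Prop) : Prop where
  notMem_tree : ∀ u, u ∈ P → u ∉ T
  root_mem : r ∈ P
  level_nonempty : ∀ u, u ∈ P → ∃ t, t ∈ T ∧ G.Adj u t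
  exists_level : ∀ t, t ∈ T → ∃ u, u ∈ P ∧ G.Adj u t
  level_unique : ∀ t u u', t ∈ T → u ∈ P → u' ∈ P → G.Adj u t → G.Adj u' t → u = u'
  root_unique : ∀ t t', t ∈ T → t' ∈ T → G.Adj r t → G.Adj r t' → t = t'
  nxt_spec : ∀ u v, nxt u v → u ∈ P ∧ v ∈ P ∧ G.Adj u v
  nxt_of_adj : ∀ u v, u ∈ P → v ∈ P → G.Adj u v → nxt u v ∨ nxt v u
  exists_pred : ∀ u, u ∈ P → u = r ∨ ∃ v, nxt v u
  succ_unique : ∀ u v w, nxt u v → nxt u w → v = w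
  pred_unique : ∀ u v w, nxt v u → nxt w u → v = w
  child_of_adj : ∀ t s, t ∈ T → s ∈ T → G.Adj t s → IsChild G T nxt t s ∨ IsChild G T nxt s t
  exists_parent : ∀ s u, s ∈ T → u ∈ P → G.Adj u s → u = r ∨ ∃ t, IsChild G T nxt t s
  parent_unique : ∀ s t t', IsChild G T nxt t s → IsChild G T nxt t' s → t = t'

/-- Conditions saying that `P ∪ T` induces some `W_a`. -/
structure IsLayering {V : Type*} (G : SimpleGraph V) (P T : Set V) (r : V)
    (nxt : V → V → Prop) : Prop extends IsPreLayering G P T r nxt where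
  exists_children : ∀ t, t ∈ T → (∃ u v, G.Adj u t ∧ nxt u v) →
    ∃ c : Fin 4 → V, Function.Injective c ∧ ∀ s, IsChild G T nxt t s ↔ ∃ i, c i = s

/-! ### Recovering `W_a` from a layering by counting levels -/

namespace IsLayering
variable {V : Type*} {G : SimpleGraph V} {P T : Set V} {r : V} {nxt : V → V → Prop}

theorem child_level (h : IsLayering G P T r nxt) {t s u : V} (hts : IsChild G T nxt t s)
    (hu : u ∈ P) (hut : G.Adj u t) : ∃ v, nxt u v ∧ G.Adj v s := by
  obtain ⟨ht, hs, -, u', v, hu't, hvs, huv⟩ := hts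
  obtain rfl := h.level_unique t u u' ht hu (h.nxt_spec _ _ huv).1 hut hu't
  exact ⟨v, huv, hvs⟩

theorem parent_level (h : IsLayering G P T r nxt) {t s v : V} (hts : IsChild G T nxt t s)
    (hv : v ∈ P) (hvs : G.Adj v s) : ∃ u, nxt u v ∧ G.Adj u t := by
  obtain ⟨ht, hs, -, u, v', hut, hv's, huv⟩ := hts
  obtain rfl := h.level_unique s v v' hs hv (h.nxt_spec _ _ huv).2.1 hvs hv's
  exact ⟨u, huv, hut⟩

/-- The number of tree vertices on the level of `u`. -/
noncomputable def levelCard (G : SimpleGraph V) (T : Set V) (u : V) : ℕ :=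
  {t | t ∈ T ∧ G.Adj u t}.ncard

theorem levelCard_root (h : IsLayering G P T r nxt) : levelCard G T r = 1 := by
  obtain ⟨t, ht, hrt⟩ := h.level_nonempty r h.root_mem
  rw [levelCard, Set.ncard_eq_one]
  refine ⟨t, ?_⟩
  ext s
  exact ⟨fun hs => h.root_unique s t hs.1 ht hs.2 hrt, by rintro rfl; exact ⟨ht, hrt⟩⟩

/-- Double counting of parent-child pairs between the levels of `u` and `v`: every vertex of the
upper level has four children, all on the level of `v`, and every vertex of the lower level has
exactly one parent, on the level of `u`. -/
theorem levelCard_nxt [Finite V] (h : IsLayering G P T r nxt) {u v : V} (huv : nxt u v) :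
    levelCard G T v = 4 * levelCard G T u := by
  classical
  have := Fintype.ofFinite V
  have hu := (h.nxt_spec _ _ huv).1
  have hv := (h.nxt_spec _ _ huv).2.1
  have key := Finset.card_mul_eq_card_mul (s := Finset.univ.filter fun t => t ∈ T ∧ G.Adj u t)
    (t := Finset.univ.filter fun t => t ∈ T ∧ G.Adj v t) (IsChild G T nxt) (m := 4) (n := 1) ?_ ?_
  · rw [levelCard, levelCard, Set.ncard_eq_toFinset_card', Set.ncard_eq_toFinset_card']
    simp only [Set.toFinset_ofPred]
    omega
  · intro t ht
    simp only [Finset.mem_filter, Finset.mem_univ, true_and] at ht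
    obtain ⟨c, hc, hcs⟩ := h.exists_children t ht.1 ⟨u, v, ht.2, huv⟩
    have : Finset.bipartiteAbove (IsChild G T nxt)
        (Finset.univ.filter fun t => t ∈ T ∧ G.Adj v t) t = Finset.univ.image c := by
      ext s
      simp only [Finset.mem_bipartiteAbove, Finset.mem_filter, Finset.mem_univ, true_and,
        Finset.mem_image, ← hcs]
      refine ⟨fun hs => hs.2, fun hs => ⟨⟨hs.2.1, ?_⟩, hs⟩⟩
      obtain ⟨v', huv', hv's⟩ := h.child_level hs hu ht.2
      rwa [h.succ_unique _ _ _ huv huv']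
    rw [this, Finset.card_image_of_injective _ hc]
    simp
  · intro s hs
    simp only [Finset.mem_filter, Finset.mem_univ, true_and] at hs
    -- If `v` were the root, four distinct children would lie on the root level, which has only one
    -- tree vertex.
    have hvr : v ≠ r := by
      rintro rfl
      obtain ⟨t, ht, hut⟩ := h.level_nonempty u hu
      obtain ⟨c, hc, hcs⟩ := h.exists_children t ht ⟨u, v, hut, huv⟩
      have hmem : ∀ i, c i ∈ T ∧ G.Adj v (c i) := by
        intro i
        have hci := (hcs (c i)).2 ⟨i, rfl⟩
        obtain ⟨v', huv', hv's⟩ := h.child_level hci hu hut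
        rw [← h.succ_unique _ _ _ huv huv'] at hv's
        exact ⟨hci.2.1, hv's⟩
      have := hc (h.root_unique _ _ (hmem 0).1 (hmem 1).1 (hmem 0).2 (hmem 1).2)
      simp at this
    obtain ⟨t, hts⟩ := (h.exists_parent s v hs.1 hv hs.2).resolve_left hvr
    rw [Finset.card_eq_one]
    refine ⟨t, ?_⟩
    ext t'
    simp only [Finset.mem_bipartiteBelow, Finset.mem_filter, Finset.mem_univ, true_and,
      Finset.mem_singleton]
    refine ⟨fun ht' => h.parent_unique _ _ _ ht'.2 hts, ?_⟩
    rintro rfl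
    obtain ⟨u', hu'v, hu't⟩ := h.parent_level hts hv hs.2
    refine ⟨⟨hts.1, ?_⟩, hts⟩
    rwa [h.pred_unique _ _ _ huv hu'v]

theorem levelCard_pos [Finite V] (h : IsLayering G P T r nxt) {u : V} (hu : u ∈ P) :
    0 < levelCard G T u := by
  rw [levelCard, Set.ncard_pos]
  exact h.level_nonempty u hu

/-- Strong induction on the level size: a predecessor has a level four times smaller, and levels are
nonempty, so the chain of predecessors cannot cycle and must reach the root. -/
theorem exists_levelCard_eq_pow [Finite V] (h : IsLayering G P T r nxt) {u : V} (hu : u ∈ P) :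
    ∃ i : ℕ, levelCard G T u = 4 ^ i := by
  induction hn : levelCard G T u using Nat.strong_induction_on generalizing u with
  | _ n ih =>
    rcases h.exists_pred u hu with rfl | ⟨v, hvu⟩
    · exact ⟨0, by rw [← hn, h.levelCard_root, pow_zero]⟩
    · have hv := (h.nxt_spec _ _ hvu).1
      have h4 := h.levelCard_nxt hvu
      have hpos := h.levelCard_pos hv
      obtain ⟨i, hi⟩ := ih _ (by omega) hv rfl
      exact ⟨i + 1, by rw [← hn, h4, hi, pow_succ']⟩

theorem eq_root_of_levelCard_eq_one [Finite V] (h : IsLayering G P T r nxt) {u : V} (hu : u ∈ P)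
    (h1 : levelCard G T u = 1) : u = r := by
  rcases h.exists_pred u hu with rfl | ⟨v, hvu⟩
  · rfl
  · have h4 := h.levelCard_nxt hvu
    omega

/-- Path vertices with equally large levels are traced back in parallel to the root; uniqueness of
successors then identifies them. This excludes further components of the path. -/
theorem eq_of_levelCard_eq [Finite V] (h : IsLayering G P T r nxt) {i : ℕ} {u v : V} (hu : u ∈ P)
    (hv : v ∈ P) (hui : levelCard G T u = 4 ^ i) (hvi : levelCard G T v = 4 ^ i) : u = v := by
  induction i generalizing u v with
  | zero =>
    rw [h.eq_root_of_levelCard_eq_one hu hui, h.eq_root_of_levelCard_eq_one hv hvi]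
  | succ i ih =>
    have key : ∀ w ∈ P, levelCard G T w = 4 ^ (i + 1) →
        ∃ w', nxt w' w ∧ w' ∈ P ∧ levelCard G T w' = 4 ^ i := by
      intro w hw hwi
      rcases h.exists_pred w hw with rfl | ⟨w', hw'⟩
      · rw [h.levelCard_root, pow_succ] at hwi
        omega
      · refine ⟨w', hw', (h.nxt_spec _ _ hw').1, ?_⟩
        have h4 := h.levelCard_nxt hw'
        rw [pow_succ] at hwi
        omega
    obtain ⟨u', hu'u, hu', hu'i⟩ := key u hu hui
    obtain ⟨v', hv'v, hv', hv'i⟩ := key v hv hvi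
    obtain rfl := ih hu' hv' hu'i hv'i
    exact h.succ_unique _ _ _ hu'u hv'v

/-- The path vertices can be enumerated along `nxt`. -/
theorem exists_path [Finite V] (h : IsLayering G P T r nxt) :
    ∃ (a : ℕ+) (f : ℕ → V), f 0 = r ∧ (∀ u, u ∈ P ↔ ∃ i, i < (a : ℕ) ∧ f i = u) ∧
      (∀ i j, i < (a : ℕ) → j < (a : ℕ) → f i = f j → i = j) ∧
      ∀ i j, i < (a : ℕ) → j < (a : ℕ) → (nxt (f i) (f j) ↔ i + 1 = j) := by
  have : Nonempty V := ⟨r⟩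
  choose! idx hidx using fun u (hu : u ∈ P) => h.exists_levelCard_eq_pow hu
  have idx_inj : ∀ u ∈ P, ∀ v ∈ P, idx u = idx v → u = v := fun u hu v hv huv =>
    h.eq_of_levelCard_eq hu hv (hidx u hu) (huv ▸ hidx v hv)
  have idx_nxt : ∀ u v, nxt u v → idx v = idx u + 1 := by
    intro u v huv
    have h4 := h.levelCard_nxt huv
    rw [hidx _ (h.nxt_spec _ _ huv).1, hidx _ (h.nxt_spec _ _ huv).2.1, ← pow_succ'] at h4
    exact Nat.pow_right_injective (by norm_num : 2 ≤ 4) h4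
  have idx_root : idx r = 0 := by
    have := hidx r h.root_mem
    rw [h.levelCard_root] at this
    exact (Nat.pow_eq_one.1 this.symm).resolve_left (by norm_num)
  -- Going back along predecessors lowers the index by one each time, so all indices below an
  -- attained one are attained.
  have down : ∀ n, ∀ u ∈ P, idx u = n → ∀ i ≤ n, ∃ v ∈ P, idx v = i := by
    intro n
    induction n with
    | zero =>
      intro u hu hun i hi
      exact ⟨u, hu, by omega⟩
    | succ n ih =>
      intro u hu hun i hi
      rcases hi.eq_or_lt with rfl | hi
      · exact ⟨u, hu, hun⟩
      · rcases h.exists_pred u hu with rfl | ⟨v, hvu⟩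
        · omega
        · have := idx_nxt _ _ hvu
          exact ih v (h.nxt_spec _ _ hvu).1 (by omega) i (by omega)
  -- The indices run from zero to the maximal one, hence the number of levels is `idx m + 1`.
  obtain ⟨m, hm, hmax⟩ := Set.exists_max_image P idx P.toFinite ⟨r, h.root_mem⟩
  choose! f hfP hf using down (idx m) m hm rfl
  refine ⟨⟨idx m + 1, by omega⟩, f, ?_, fun u => ⟨fun hu => ?_, ?_⟩, ?_, ?_⟩
  · exact idx_inj _ (hfP 0 (by omega)) _ h.root_mem (by rw [hf 0 (by omega), idx_root])
  · have := hmax u hu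
    exact ⟨idx u, by simp only [PNat.mk_coe]; omega,
      idx_inj _ (hfP _ this) _ hu (hf _ this)⟩
  · rintro ⟨i, hi, rfl⟩
    simp only [PNat.mk_coe] at hi
    exact hfP i (by omega)
  · intro i j hi hj hij
    simp only [PNat.mk_coe] at hi hj
    rw [← hf i (by omega), ← hf j (by omega), hij]
  · intro i j hi hj
    simp only [PNat.mk_coe] at hi hj
    constructor
    · intro hij
      have := idx_nxt _ _ hij
      rw [hf i (by omega), hf j (by omega)] at this
      omega
    · rintro rfl
      rcases h.exists_pred _ (hfP (i + 1) (by omega)) with hr | ⟨v, hv⟩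
      · have := hf (i + 1) (by omega)
        rw [hr, idx_root] at this
        omega
      · have h1 := idx_nxt _ _ hv
        rw [hf (i + 1) (by omega)] at h1
        rwa [← idx_inj v (h.nxt_spec _ _ hv).1 (f i) (hfP i (by omega))
          (by rw [hf i (by omega)]; omega)]

/-- The tree is addressed by words: the empty word goes to the tree vertex on the root level, and `c
:: w` to the child number `c` of the image of `w`. Unique parents give injectivity, and climbing to
parents level by level shows that every tree vertex has an address. -/
theorem exists_embedding [Finite V] (h : IsLayering G P T r nxt) :
    ∃ (a : ℕ+) (f : graphW a ↪g G), Set.range f = P ∪ T := by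
  classical
  obtain ⟨a, f, hf0, hfP, hf_inj, hf_nxt⟩ := h.exists_path
  have hfmem : ∀ i, i < (a : ℕ) → f i ∈ P := fun i hi => (hfP _).2 ⟨i, hi, rfl⟩
  obtain ⟨ρ, hρ, hrρ⟩ := h.level_nonempty r h.root_mem
  -- The enumeration of children is made total, with a constant junk value where the axiom on
  -- children does not apply, so that `τ` can be defined by plain recursion on words.
  have hch : ∀ t : V, ∃ c : Fin 4 → V, t ∈ T → (∃ u v, G.Adj u t ∧ nxt u v) →
      Function.Injective c ∧ ∀ s, IsChild G T nxt t s ↔ ∃ i, c i = s := by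
    intro t
    by_cases ht : t ∈ T ∧ ∃ u v, G.Adj u t ∧ nxt u v
    · obtain ⟨c, hc⟩ := h.exists_children t ht.1 ht.2
      exact ⟨c, fun _ _ => hc⟩
    · exact ⟨fun _ => t, fun h1 h2 => absurd ⟨h1, h2⟩ ht⟩
  choose ch hch using hch
  let τ : List (Fin 4) → V := fun w => w.rec ρ fun c _ t => ch t c
  have τ_cons : ∀ c w, τ (c :: w) = ch (τ w) c := fun _ _ => rfl
  have has_nxt : ∀ i t, i + 1 < (a : ℕ) → G.Adj (f i) t → ∃ u v, G.Adj u t ∧ nxt u v :=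
    fun i t hi hit => ⟨f i, f (i + 1), hit, (hf_nxt _ _ (by omega) hi).2 rfl⟩
  have child_adj : ∀ i t s, i < (a : ℕ) → G.Adj (f i) t → IsChild G T nxt t s →
      i + 1 < (a : ℕ) ∧ G.Adj (f (i + 1)) s := by
    intro i t s hi hit hts
    obtain ⟨v, hv, hvs⟩ := h.child_level hts (hfmem i hi) hit
    obtain ⟨j, hj, rfl⟩ := (hfP v).1 (h.nxt_spec _ _ hv).2.1
    obtain rfl := (hf_nxt _ _ hi hj).1 hv
    exact ⟨hj, hvs⟩
  have τ_spec : ∀ w : List (Fin 4), w.length < (a : ℕ) → τ w ∈ T ∧ G.Adj (f w.length) (τ w) := by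
    intro w
    induction w with
    | nil => exact fun _ => ⟨hρ, by rw [List.length_nil, hf0]; exact hrρ⟩
    | cons c w ih =>
      intro hw
      rw [List.length_cons] at hw
      obtain ⟨h1, h2⟩ := ih (by omega)
      have h3 := ((hch (τ w) h1 (has_nxt _ _ hw h2)).2 (τ (c :: w))).2 ⟨c, rfl⟩
      exact ⟨h3.2.1, (child_adj _ _ _ (by omega) h2 h3).2⟩
  have τ_child : ∀ (c : Fin 4) (w : List (Fin 4)), w.length + 1 < (a : ℕ) →
      IsChild G T nxt (τ w) (τ (c :: w)) := by
    intro c w hw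
    obtain ⟨h1, h2⟩ := τ_spec w (by omega)
    exact ((hch (τ w) h1 (has_nxt _ _ hw h2)).2 (τ (c :: w))).2 ⟨c, rfl⟩
  have f_adj_τ : ∀ i w, i < (a : ℕ) → w.length < (a : ℕ) → (G.Adj (f i) (τ w) ↔ i = w.length) := by
    intro i w hi hw
    obtain ⟨h1, h2⟩ := τ_spec w hw
    constructor
    · intro h3
      exact hf_inj _ _ hi hw (h.level_unique _ _ _ h1 (hfmem _ hi) (hfmem _ hw) h3 h2)
    · rintro rfl
      exact h2
  have τ_inj : ∀ w w' : List (Fin 4), w.length < (a : ℕ) → w'.length < (a : ℕ) → τ w = τ w' →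
      w = w' := by
    intro w
    induction w with
    | nil =>
      intro w' hw hw' hww'
      have := (f_adj_τ _ w' hw hw').1 (hww' ▸ (τ_spec _ hw).2)
      exact (List.length_eq_zero_iff.1 this.symm).symm
    | cons c w ih =>
      intro w' hw hw' hww'
      have hlen := (f_adj_τ _ w' hw hw').1 (hww' ▸ (τ_spec _ hw).2)
      cases w' with
      | nil => simp at hlen
      | cons c' w' =>
        rw [List.length_cons] at hw hw'
        obtain rfl := ih w' (by omega) (by omega)
          (h.parent_unique _ _ _ (τ_child c w hw) (hww' ▸ τ_child c' w' hw'))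
        obtain ⟨h1, h2⟩ := τ_spec w (by omega)
        rw [(hch (τ w) h1 (has_nxt _ _ hw h2)).1 hww']
  have τ_surj : ∀ i, i < (a : ℕ) → ∀ t ∈ T, G.Adj (f i) t →
      ∃ w : List (Fin 4), w.length = i ∧ τ w = t := by
    intro i
    induction i with
    | zero =>
      intro hi t ht hit
      rw [hf0] at hit
      exact ⟨[], rfl, h.root_unique _ _ hρ ht hrρ hit⟩
    | succ i ih =>
      intro hi t ht hit
      rcases h.exists_parent t _ ht (hfmem _ hi) hit with hr | ⟨s, hst⟩
      · rw [← hf0] at hr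
        have := hf_inj _ _ hi a.pos hr
        omega
      · obtain ⟨u, hu, hus⟩ := h.parent_level hst (hfmem _ hi) hit
        obtain ⟨j, hj, rfl⟩ := (hfP u).1 (h.nxt_spec _ _ hu).1
        obtain rfl : j = i := by
          have := (hf_nxt _ _ hj hi).1 hu
          omega
        obtain ⟨w, hw, rfl⟩ := ih hj s hst.1 hus
        obtain ⟨c, hc⟩ := ((hch _ hst.1 (has_nxt _ _ hi hus)).2 t).1 hst
        exact ⟨c :: w, by simp [hw], hc⟩
  have τ_of_child : ∀ w w', w.length < (a : ℕ) → w'.length < (a : ℕ) →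
      IsChild G T nxt (τ w) (τ w') → ∃ c, w' = c :: w := by
    intro w w' hw hw' hww'
    obtain ⟨h1, h2⟩ := τ_spec w hw
    have h3 := (child_adj _ _ _ hw h2 hww').1
    obtain ⟨c, hc⟩ := ((hch _ h1 (has_nxt _ _ h3 h2)).2 _).1 hww'
    exact ⟨c, (τ_inj (c :: w) w' (by simpa using h3) hw' hc).symm⟩
  let F : Fin (a : ℕ) ⊕ {w : List (Fin 4) // w.length < (a : ℕ)} → V :=
    Sum.elim (fun i => f i) (fun w => τ w.1)
  have F_inj : Function.Injective F := by
    rintro (⟨i, hi⟩ | ⟨w, hw⟩) (⟨j, hj⟩ | ⟨w', hw'⟩) hij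
    · simpa using hf_inj _ _ hi hj hij
    · have hij : f i = τ w' := hij
      exact absurd (τ_spec w' hw').1 (hij ▸ h.notMem_tree _ (hfmem _ hi))
    · have hij : f j = τ w := hij.symm
      exact absurd (τ_spec w hw).1 (hij ▸ h.notMem_tree _ (hfmem _ hj))
    · simpa using τ_inj _ _ hw hw' hij
  have F_adj : ∀ x y, G.Adj (F x) (F y) ↔ (graphW a).Adj x y := by
    rintro (⟨i, hi⟩ | ⟨w, hw⟩) (⟨j, hj⟩ | ⟨w', hw'⟩)
    · rw [graphW_adj_inl_inl]
      change G.Adj (f i) (f j) ↔ i + 1 = j ∨ j + 1 = i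
      rw [← hf_nxt i j hi hj, ← hf_nxt j i hj hi]
      refine ⟨h.nxt_of_adj _ _ (hfmem _ hi) (hfmem _ hj), ?_⟩
      rintro (h1 | h1)
      · exact (h.nxt_spec _ _ h1).2.2
      · exact (h.nxt_spec _ _ h1).2.2.symm
    · rw [graphW_adj_inl_inr]
      exact f_adj_τ i w' hi hw'
    · rw [graphW_adj_inr_inl, G.adj_comm]
      exact f_adj_τ j w hj hw
    · rw [graphW_adj_inr_inr]
      change G.Adj (τ w) (τ w') ↔ (∃ c, w' = c :: w) ∨ ∃ c, w = c :: w'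
      constructor
      · intro h1
        rcases h.child_of_adj _ _ (τ_spec w hw).1 (τ_spec w' hw').1 h1 with h2 | h2
        · exact Or.inl (τ_of_child _ _ hw hw' h2)
        · exact Or.inr (τ_of_child _ _ hw' hw h2)
      · rintro (⟨c, rfl⟩ | ⟨c, rfl⟩)
        · exact (τ_child c w hw').2.2.1
        · exact (τ_child c w' hw).2.2.1.symm
  refine ⟨a, ⟨⟨F, F_inj⟩, fun {x y} => F_adj x y⟩, ?_⟩
  apply Set.Subset.antisymm
  · rintro _ ⟨i | w, rfl⟩
    · exact Or.inl (hfmem _ i.2)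
    · exact Or.inr (τ_spec _ w.2).1
  · rintro x (hx | hx)
    · obtain ⟨i, hi, rfl⟩ := (hfP x).1 hx
      exact ⟨.inl ⟨i, hi⟩, rfl⟩
    · obtain ⟨u, hu, hux⟩ := h.exists_level x hx
      obtain ⟨i, hi, rfl⟩ := (hfP u).1 hu
      obtain ⟨w, hw, rfl⟩ := τ_surj i hi x hx hux
      exact ⟨.inr ⟨w, hw ▸ hi⟩, rfl⟩

end IsLayering

/-! ### The layering of a copy of `graphW` -/

section Copy
variable {V : Type*} {G : SimpleGraph V} {a : ℕ+} (f : graphW a ↪g G)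

/-- The successor relation on the path of a copy of `W_a`. -/
def copyNxt (x y : V) : Prop :=
  ∃ i j : Fin (a : ℕ), (i : ℕ) + 1 = j ∧ f (.inl i) = x ∧ f (.inl j) = y

variable {f} in
theorem copyNxt_iff {i j : Fin (a : ℕ)} :
    copyNxt f (f (.inl i)) (f (.inl j)) ↔ (i : ℕ) + 1 = j := by
  simp [copyNxt]

variable {f} in
theorem isChild_copy_iff {x y : V} :
    IsChild G (Set.range fun w => f (.inr w)) (copyNxt f) x y ↔
      ∃ w w' : {w : List (Fin 4) // w.length < (a : ℕ)},
        (∃ c, w'.1 = c :: w.1) ∧ f (.inr w) = x ∧ f (.inr w') = y := by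
  constructor
  · rintro ⟨⟨w, rfl⟩, ⟨w', rfl⟩, hadj, _, _, hu, hv, i, j, hij, rfl, rfl⟩
    simp only [f.map_adj_iff, graphW_adj_inl_inr, graphW_adj_inr_inr] at hadj hu hv
    refine ⟨w, w', ?_, rfl, rfl⟩
    refine hadj.resolve_right ?_
    rintro ⟨c, hc⟩
    have := congrArg List.length hc
    rw [List.length_cons] at this
    omega
  · rintro ⟨w, w', ⟨c, hc⟩, rfl, rfl⟩
    refine ⟨⟨w, rfl⟩, ⟨w', rfl⟩, by simp [hc], f (.inl ⟨_, w.2⟩), f (.inl ⟨_, w'.2⟩), by simp,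
      by simp, ?_⟩
    rw [copyNxt_iff]
    simp [hc]

theorem isLayering_copy : IsLayering G (Set.range fun i => f (.inl i))
    (Set.range fun w => f (.inr w)) (f (.inl ⟨0, a.pos⟩)) (copyNxt f) where
  notMem_tree := by
    rintro _ ⟨i, rfl⟩ ⟨w, hw⟩
    simpa using f.injective hw
  root_mem := ⟨_, rfl⟩
  level_nonempty := by
    rintro _ ⟨i, rfl⟩
    refine ⟨_, ⟨⟨List.replicate i 0, by simp⟩, rfl⟩, ?_⟩
    simp
  exists_level := by
    rintro _ ⟨w, rfl⟩
    exact ⟨_, ⟨⟨w.1.length, w.2⟩, rfl⟩, by simp⟩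
  level_unique := by
    rintro _ _ _ ⟨w, rfl⟩ ⟨i, rfl⟩ ⟨j, rfl⟩ hi hj
    simp only [f.map_adj_iff, graphW_adj_inl_inr] at hi hj
    rw [Fin.ext (hi.trans hj.symm)]
  root_unique := by
    rintro _ _ ⟨w, rfl⟩ ⟨w', rfl⟩ hw hw'
    simp only [f.map_adj_iff, graphW_adj_inl_inr] at hw hw'
    rw [Subtype.ext ((List.length_eq_zero_iff.1 hw.symm).trans
      (List.length_eq_zero_iff.1 hw'.symm).symm)]
  nxt_spec := by
    rintro _ _ ⟨i, j, hij, rfl, rfl⟩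
    exact ⟨⟨i, rfl⟩, ⟨j, rfl⟩, by simp [hij]⟩
  nxt_of_adj := by
    rintro _ _ ⟨i, rfl⟩ ⟨j, rfl⟩ hij
    simpa only [f.map_adj_iff, graphW_adj_inl_inl, copyNxt_iff] using hij
  exists_pred := by
    rintro _ ⟨⟨i, hi⟩, rfl⟩
    rcases i with _ | i
    · exact Or.inl rfl
    · exact Or.inr ⟨f (.inl ⟨i, by omega⟩), copyNxt_iff.2 rfl⟩
  succ_unique := by
    rintro _ _ _ ⟨i, j, hij, rfl, rfl⟩ ⟨i', j', hij', hi, rfl⟩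
    obtain rfl : i' = i := by simpa using f.injective hi
    rw [Fin.ext (hij.symm.trans hij')]
  pred_unique := by
    rintro _ _ _ ⟨i, j, hij, rfl, rfl⟩ ⟨i', j', hij', rfl, hj⟩
    obtain rfl : j' = j := by simpa using f.injective hj
    rw [Fin.ext (by omega : (i : ℕ) = i')]
  child_of_adj := by
    rintro _ _ ⟨w, rfl⟩ ⟨w', rfl⟩ h
    simp only [f.map_adj_iff, graphW_adj_inr_inr] at h
    rw [isChild_copy_iff, isChild_copy_iff]
    exact h.imp (fun h => ⟨w, w', h, rfl, rfl⟩) (fun h => ⟨w', w, h, rfl, rfl⟩)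
  exists_parent := by
    rintro _ _ ⟨⟨w, hw⟩, rfl⟩ ⟨i, rfl⟩ h
    simp only [f.map_adj_iff, graphW_adj_inl_inr] at h
    rcases w with _ | ⟨c, w⟩
    · obtain rfl : i = ⟨0, a.pos⟩ := Fin.ext h
      exact Or.inl rfl
    · refine Or.inr ⟨f (.inr ⟨w, by simp at hw; omega⟩), isChild_copy_iff.2 ?_⟩
      exact ⟨_, _, ⟨c, rfl⟩, rfl, rfl⟩
  parent_unique := by
    intro s t t' ht ht'
    rw [isChild_copy_iff] at ht ht'
    obtain ⟨w, w', ⟨c, hc⟩, rfl, rfl⟩ := ht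
    obtain ⟨v, v', ⟨d, hd⟩, rfl, hv⟩ := ht'
    obtain rfl : v' = w' := by simpa using f.injective hv
    rw [hc, List.cons.injEq] at hd
    rw [show w = v from Subtype.ext hd.2]
  exists_children := by
    rintro _ ⟨w, rfl⟩ ⟨_, _, hu, i, j, hij, rfl, rfl⟩
    simp only [f.map_adj_iff, graphW_adj_inl_inr] at hu
    refine ⟨fun c => f (.inr ⟨c :: w.1, by rw [List.length_cons]; omega⟩), ?_, ?_⟩
    · intro c d hcd
      simpa using f.injective hcd
    · intro s
      rw [isChild_copy_iff]
      constructor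
      · rintro ⟨v, v', ⟨c, hc⟩, hv, rfl⟩
        obtain rfl : v = w := by simpa using f.injective hv
        exact ⟨c, by simp [← hc]⟩
      · rintro ⟨c, rfl⟩
        exact ⟨_, _, ⟨c, rfl⟩, rfl, rfl⟩

theorem range_copy : Set.range f = (Set.range fun i => f (.inl i)) ∪
    Set.range fun w => f (.inr w) := by
  ext x
  simp

end Copy

end EMSOGraph

namespace EMSOGraph

/-! ### Building formulas -/

namespace FOFormula
variable {m k : ℕ} {V : Type*} {G : SimpleGraph V} {S : Fin m → Set V}

/-- Existential quantification over a list of variables. -/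
def exs (l : List (Fin k)) (φ : FOFormula m k) : FOFormula m k := l.foldr ex φ

/-- The universal closure of a formula. -/
def close (φ : FOFormula m k) : FOFormula m k := (List.finRange k).foldr all φ

/-- The conjunction of a list of formulas. -/
def conj [NeZero k] (l : List (FOFormula m k)) : FOFormula m k := l.foldr and (eq 0 0)

theorem realize_conj [NeZero k] {l : List (FOFormula m k)} {v : Fin k → V} :
    (conj l).Realize G S v ↔ ∀ φ ∈ l, φ.Realize G S v := by
  induction l with
  | nil => simp [conj, Realize]
  | cons φ l ih =>
    rw [List.forall_mem_cons, ← ih]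
    rfl

theorem realize_exs {l : List (Fin k)} {φ : FOFormula m k} {v : Fin k → V} :
    (exs l φ).Realize G S v ↔ ∃ w, (∀ i, i ∉ l → w i = v i) ∧ φ.Realize G S w := by
  induction l generalizing v with
  | nil =>
    constructor
    · exact fun h => ⟨v, fun _ _ => rfl, h⟩
    · rintro ⟨w, hw, h⟩
      rwa [show w = v from funext fun i => hw i (by simp)] at h
  | cons j l ih =>
    change (∃ b, (exs l φ).Realize G S (Function.update v j b)) ↔ _
    simp only [ih]
    constructor
    · rintro ⟨b, w, hw, h⟩
      refine ⟨w, fun i hi => ?_, h⟩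
      rw [List.mem_cons, not_or] at hi
      rw [hw i hi.2, Function.update_of_ne hi.1]
    · rintro ⟨w, hw, h⟩
      refine ⟨w j, w, fun i hi => ?_, h⟩
      by_cases hij : i = j
      · rw [hij, Function.update_self]
      · rw [Function.update_of_ne hij, hw i (by simp [hij, hi])]

theorem realize_exs_ofFn {j : ℕ} {c : Fin j → Fin k} (hc : Function.Injective c)
    {φ : FOFormula m k} {v : Fin k → V} :
    (exs (List.ofFn c) φ).Realize G S v ↔
      ∃ y : Fin j → V, φ.Realize G S (Function.extend c y v) := by
  rw [realize_exs]
  constructor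
  · rintro ⟨w, hw, h⟩
    refine ⟨w ∘ c, ?_⟩
    convert h
    ext i
    by_cases hi : ∃ t, c t = i
    · obtain ⟨t, rfl⟩ := hi
      rw [hc.extend_apply, Function.comp_apply]
    · rw [Function.extend_apply' _ _ _ hi, hw i (by simpa [List.mem_ofFn] using hi)]
  · rintro ⟨y, h⟩
    refine ⟨_, fun i hi => Function.extend_apply' _ _ _ ?_, h⟩
    simpa [List.mem_ofFn] using hi

theorem freeVars_close (φ : FOFormula m k) : φ.close.freeVars = ∅ := by
  have key : ∀ l : List (Fin k), ∀ i ∈ l, i ∉ (l.foldr all φ).freeVars := by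
    intro l
    induction l with
    | nil => simp
    | cons j l ih =>
      intro i hi
      simp only [List.foldr_cons, freeVars, Finset.mem_erase, not_and]
      exact fun hij => ih i ((List.mem_cons.1 hi).resolve_left hij)
  exact Finset.eq_empty_of_forall_notMem fun i => key _ i (List.mem_finRange i)

/-- Both sides range over all assignments, so each added universal quantifier is absorbed. -/
theorem forall_realize_close (φ : FOFormula m k) :
    (∀ v, φ.close.Realize G S v) ↔ ∀ v, φ.Realize G S v := by
  unfold close
  induction List.finRange k with
  | nil => rfl
  | cons j l ih =>
    rw [← ih, List.foldr_cons]
    constructor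
    · intro h v
      simpa using h v (v j)
    · exact fun h v b => h _

/-- The variables `c 0, c 1, …` have pairwise distinct values. -/
def distinct [NeZero k] {j : ℕ} (c : Fin j → Fin k) : FOFormula m k :=
  conj ((List.finRange j).map fun s => conj (((List.finRange j).filter (s ≠ ·)).map fun t =>
    neg (eq (c s) (c t))))

theorem realize_distinct [NeZero k] {j : ℕ} {c : Fin j → Fin k} {v : Fin k → V} :
    (distinct c).Realize G S v ↔ Function.Injective fun t => v (c t) := by
  simp only [distinct, realize_conj, List.mem_map, List.mem_finRange, true_and,
    forall_exists_index, forall_apply_eq_imp_iff, List.mem_filter, decide_eq_true_eq, Realize,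
    and_imp, forall_apply_eq_imp_iff₂]
  exact ⟨fun h s t hst => by_contra fun hne => h s t hne hst, fun h s t hne hst => hne (h hst)⟩

end FOFormula

/-- The sentence whose first-order part is the universal closure of a formula. -/
def FOFormula.toSentence {m k : ℕ} (φ : FOFormula m k) : EMSOSentence m k where
  body := φ.close
  closed := φ.freeVars_close

theorem FOFormula.models_toSentence {m k : ℕ} {V : Type*} [Nonempty V] {G : SimpleGraph V}
    {φ : FOFormula m k} {Q : (Fin m → Set V) → Prop} (h : ∀ S v, φ.Realize G S v ↔ Q S) :
    φ.toSentence.Models G ↔ ∃ S, Q S := by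
  simp [EMSOSentence.Models, toSentence, forall_realize_close, h]

/-! ### The first-order description of a layering -/

section PreLayering
variable {m k : ℕ} (path tree root : Fin k → FOFormula m k) (nxt : Fin k → Fin k → FOFormula m k)

/-- The formula saying that `y` is a child of `x`, with auxiliary variable `z`. -/
def childFormula (x y z : Fin k) : FOFormula m k :=
  (tree x).and ((tree y).and ((FOFormula.adj x y).and
    (.ex z ((FOFormula.adj z x).and (.ex x ((FOFormula.adj x y).and (nxt z x)))))))

/-- The formula expressing `IsPreLayering`, written with the variables `x`, `y`, `z`. -/
def preLayeringFormula (x y z : Fin k) : FOFormula m k :=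
  (FOFormula.all x ((path x).imp (tree x).neg)).and <|
  (FOFormula.all x ((root x).imp (path x))).and <|
  (FOFormula.all x ((path x).imp (.ex y ((tree y).and (.adj x y))))).and <|
  (FOFormula.all x ((tree x).imp (.ex y ((path y).and (.adj y x))))).and <|
  (FOFormula.all x (.all y (.all z ((tree x).imp ((path y).imp ((path z).imp
    ((FOFormula.adj y x).imp ((FOFormula.adj z x).imp (.eq y z))))))))).and <|
  (FOFormula.all x (.all y ((tree x).imp ((tree y).imp
    ((FOFormula.ex z ((root z).and (.adj z x))).imp
      ((FOFormula.ex z ((root z).and (.adj z y))).imp (.eq x y))))))).and <|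
  (FOFormula.all x (.all y ((nxt x y).imp ((path x).and ((path y).and (.adj x y)))))).and <|
  (FOFormula.all x (.all y ((path x).imp ((path y).imp ((FOFormula.adj x y).imp
    ((nxt x y).or (nxt y x))))))).and <|
  (FOFormula.all x ((path x).imp ((root x).or (.ex y (nxt y x))))).and <|
  (FOFormula.all x (.all y (.all z ((nxt x y).imp ((nxt x z).imp (.eq y z)))))).and <|
  (FOFormula.all x (.all y (.all z ((nxt y x).imp ((nxt z x).imp (.eq y z)))))).and <|
  (FOFormula.all x (.all y ((tree x).imp ((tree y).imp ((FOFormula.adj x y).imp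
    ((childFormula tree nxt x y z).or (childFormula tree nxt y x z))))))).and <|
  (FOFormula.all x (.all y ((tree x).imp ((path y).imp ((FOFormula.adj y x).imp
    ((root y).or (.ex z (childFormula tree nxt z x y)))))))).and <|
  FOFormula.all x (.all y (.all z ((childFormula tree nxt y x z).imp
    ((childFormula tree nxt z x y).imp (.eq y z)))))

variable {path tree root nxt} {V : Type*}

/-- On the assignments in `E`, the formulas `path i`, `tree i`, `root i`, `nxt i j` in variables
`i`, `j` from `A` define `P`, `T`, `r`, `N`. -/
structure Interprets (G : SimpleGraph V) (S : Fin m → Set V) (E : Set (Fin k → V))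
    (A : Set (Fin k)) (path tree root : Fin k → FOFormula m k)
    (nxt : Fin k → Fin k → FOFormula m k) (P T : Set V) (r : V) (N : V → V → Prop) : Prop where
  update : ∀ w ∈ E, ∀ i ∈ A, ∀ b, Function.update w i b ∈ E
  path : ∀ w ∈ E, ∀ i ∈ A, ((path i).Realize G S w ↔ w i ∈ P)
  tree : ∀ w ∈ E, ∀ i ∈ A, ((tree i).Realize G S w ↔ w i ∈ T)
  root : ∀ w ∈ E, ∀ i ∈ A, ((root i).Realize G S w ↔ w i = r)
  nxt : ∀ w ∈ E, ∀ i ∈ A, ∀ j ∈ A, ((nxt i j).Realize G S w ↔ N (w i) (w j))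

variable {G : SimpleGraph V} {S : Fin m → Set V} {E : Set (Fin k → V)} {A : Set (Fin k)}
  {P T : Set V} {r : V} {N : V → V → Prop}

/-- The inner quantifier of `childFormula` reuses `x` for the path vertex on the level of `y`. The
old value of `x` is no longer needed there, so three variable names suffice. -/
theorem Interprets.realize_child (I : Interprets G S E A path tree root nxt P T r N) {x y z : Fin k}
    (hx : x ∈ A) (hy : y ∈ A) (hz : z ∈ A) (hxy : x ≠ y) (hxz : x ≠ z) (hyz : y ≠ z)
    {w : Fin k → V} (hw : w ∈ E) :
    (childFormula tree nxt x y z).Realize G S w ↔ IsChild G T N (w x) (w y) := by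
  have hu := I.update
  simp only [childFormula, IsChild, FOFormula.Realize, I.tree w hw x hx, I.tree w hw y hy]
  -- Membership of an iterated update in `E` is discharged by repeated use of `I.update`, hence the
  -- increased depth.
  simp (maxDischargeDepth := 8) only [I.nxt, hu, hw, hx, hz, Function.update_self,
    Function.update_of_ne hxz.symm, Function.update_of_ne hxz, Function.update_of_ne hyz,
    Function.update_of_ne hxy.symm,
    exists_and_left]

theorem Interprets.realize_preLayering (I : Interprets G S E A path tree root nxt P T r N)
    {x y z : Fin k} (hx : x ∈ A) (hy : y ∈ A) (hz : z ∈ A) (hxy : x ≠ y) (hxz : x ≠ z)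
    (hyz : y ≠ z) {w : Fin k → V} (hw : w ∈ E) :
    (preLayeringFormula path tree root nxt x y z).Realize G S w ↔ IsPreLayering G P T r N := by
  have hu := I.update
  have c1 := fun w hw => I.realize_child hx hy hz hxy hxz hyz (w := w) hw
  have c2 := fun w hw => I.realize_child hy hx hz hxy.symm hyz hxz (w := w) hw
  have c3 := fun w hw => I.realize_child hz hx hy hxz.symm hyz.symm hxy (w := w) hw
  -- The formulas speak of the root only through quantified variables satisfying `root`; `forall_eq`
  -- and `exists_eq_left` substitute `r` for them.
  simp (maxDischargeDepth := 8) only [preLayeringFormula, FOFormula.Realize, c1, c2, c3, I.path,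
    I.tree, I.root, I.nxt, hu, hw, hx, hy, hz, Function.update_self, Function.update_of_ne hxz,
    Function.update_of_ne hyz, Function.update_of_ne hxy, forall_eq, exists_eq_left]
  constructor
  · rintro ⟨h1, h2, h3, h4, h5, h6, h7, h8, h9, h10, h11, h12, h13, h14⟩
    exact ⟨h1, h2, h3, h4, h5, h6, h7, h8, h9, h10, h11, h12, h13, h14⟩
  · rintro ⟨h1, h2, h3, h4, h5, h6, h7, h8, h9, h10, h11, h12, h13, h14⟩
    exact ⟨h1, h2, h3, h4, h5, h6, h7, h8, h9, h10, h11, h12, h13, h14⟩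

end PreLayering

end EMSOGraph

namespace EMSOGraph

/-! ### The sentence with one monadic variable -/

section OneSet
variable {V : Type*} {G : SimpleGraph V}

/-- `u` has at least seven neighbours in `X`. -/
def HasSevenNeighbors (G : SimpleGraph V) (X : Set V) (u : V) : Prop :=
  ∃ y : Fin 7 → V, Function.Injective y ∧ ∀ t, y t ∈ X ∧ G.Adj u (y t)

/-- The path of the copy of `W_a` on `X` whose first two path vertices are `p₀`, `p₁`. -/
def pathOf (G : SimpleGraph V) (X : Set V) (p₀ p₁ : V) : Set V :=
  {u | u ∈ X ∧ (u = p₀ ∨ u = p₁ ∨ HasSevenNeighbors G X u)}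

/-- `v` follows `u` on the path: some tree vertex on the level of `u` has two tree neighbours on the
level of `v`. -/
def NxtOf (G : SimpleGraph V) (P T : Set V) (u v : V) : Prop :=
  u ∈ P ∧ v ∈ P ∧ G.Adj u v ∧ ∃ t, t ∈ T ∧ G.Adj u t ∧ ∃ s, s ∈ T ∧ G.Adj t s ∧ G.Adj v s ∧
    ∃ s', s' ∈ T ∧ G.Adj t s' ∧ G.Adj v s' ∧ s ≠ s'

/-- The variables for seven neighbours. -/
def degVars (t : Fin 7) : Fin 19 := ⟨t + 7, by omega⟩

/-- The variables for four children. -/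
def childVars (t : Fin 4) : Fin 19 := ⟨t + 14, by omega⟩

theorem degVars_injective : Function.Injective degVars := fun s t h => by
  simpa [degVars, Fin.ext_iff] using h

theorem childVars_injective : Function.Injective childVars := fun s t h => by
  simpa [childVars, Fin.ext_iff] using h

/-- The formula saying that variable `i` lies in `pathOf`, with `p₀`, `p₁` the variables 0, 1. -/
def pathFormula (i : Fin 19) : FOFormula 1 19 :=
  (FOFormula.mem 0 i).and ((FOFormula.eq i 0).or ((FOFormula.eq i 1).or
    (.exs (List.ofFn degVars) ((FOFormula.distinct degVars).and
      (.conj ((List.finRange 7).map fun t =>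
        (FOFormula.mem 0 (degVars t)).and (.adj i (degVars t))))))))

/-- The formula saying that variable `i` lies in the tree. -/
def treeFormula (i : Fin 19) : FOFormula 1 19 := (FOFormula.mem 0 i).and (pathFormula i).neg

/-- The formula expressing `NxtOf`. -/
def nxtFormula (i j : Fin 19) : FOFormula 1 19 :=
  (pathFormula i).and ((pathFormula j).and ((FOFormula.adj i j).and
    (.ex 5 ((treeFormula 5).and ((FOFormula.adj i 5).and
      (.ex 6 ((treeFormula 6).and ((FOFormula.adj 5 6).and ((FOFormula.adj j 6).and
        (.ex 18 ((treeFormula 18).and ((FOFormula.adj 5 18).and ((FOFormula.adj j 18).and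
          (FOFormula.eq 6 18).neg)))))))))))))

/-- The formula saying that each tree vertex which is not on the last level has four children. -/
def fourChildrenFormula : FOFormula 1 19 :=
  .all 2 ((treeFormula 2).imp ((FOFormula.ex 3 (.ex 4 ((FOFormula.adj 3 2).and
    (nxtFormula 3 4)))).imp (.exs (List.ofFn childVars) ((FOFormula.distinct childVars).and
      (.all 3 ((childFormula treeFormula nxtFormula 2 3 4).iff
        ((FOFormula.eq 14 3).or ((FOFormula.eq 15 3).or ((FOFormula.eq 16 3).or
          (FOFormula.eq 17 3))))))))))

/-- The first-order part of the sentence with one monadic variable. -/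
def oneSetFormula : FOFormula 1 19 :=
  .ex 0 (.ex 1 ((FOFormula.mem 0 0).and ((FOFormula.mem 0 1).and
    ((preLayeringFormula pathFormula treeFormula (FOFormula.eq · 0) nxtFormula 2 3 4).and
      (fourChildrenFormula.and
        (.all 2 ((FOFormula.mem 0 2).or (.ex 3 ((FOFormula.mem 0 3).and (.adj 2 3))))))))))

variable {S : Fin 1 → Set V}

/-- Layout of the 19 variables: 0 and 1 hold the first two path vertices, 2 to 4 serve the layering
axioms, 5, 6 and 18 are auxiliary for the successor relation, 7 to 13 hold seven neighbours, and 14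
to 17 hold four children. Quantifying a block leaves the other variables unchanged. -/
theorem extend_degVars {y : Fin 7 → V} {w : Fin 19 → V} {i : Fin 19}
    (hi : (i : ℕ) < 7 ∨ 13 < (i : ℕ)) : Function.extend degVars y w i = w i := by
  refine Function.extend_apply' _ _ _ ?_
  rintro ⟨t, rfl⟩
  simp only [degVars] at hi
  omega

theorem extend_childVars {y : Fin 4 → V} {w : Fin 19 → V} {i : Fin 19}
    (hi : (i : ℕ) < 14) : Function.extend childVars y w i = w i := by
  refine Function.extend_apply' _ _ _ ?_
  rintro ⟨t, rfl⟩
  simp only [childVars] at hi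
  omega

theorem realize_pathFormula {i : Fin 19} (hi : (i : ℕ) < 7 ∨ 13 < (i : ℕ)) {w : Fin 19 → V} :
    (pathFormula i).Realize G S w ↔ w i ∈ pathOf G (S 0) (w 0) (w 1) := by
  simp only [pathFormula, FOFormula.Realize, FOFormula.realize_exs_ofFn degVars_injective,
    FOFormula.realize_distinct, FOFormula.realize_conj, List.mem_map, List.mem_finRange, true_and,
    forall_exists_index, forall_apply_eq_imp_iff, degVars_injective.extend_apply,
    extend_degVars hi, pathOf, HasSevenNeighbors, Set.mem_ofPred_eq]

theorem realize_treeFormula {i : Fin 19} (hi : (i : ℕ) < 7 ∨ 13 < (i : ℕ)) {w : Fin 19 → V} :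
    (treeFormula i).Realize G S w ↔ w i ∈ S 0 \ pathOf G (S 0) (w 0) (w 1) := by
  simp only [treeFormula, FOFormula.Realize, realize_pathFormula hi, Set.mem_sdiff]

theorem realize_nxtFormula {i j : Fin 19} (hi : (i : ℕ) < 5) (hj : (j : ℕ) < 5) {w : Fin 19 → V} :
    (nxtFormula i j).Realize G S w ↔ NxtOf G (pathOf G (S 0) (w 0) (w 1))
      (S 0 \ pathOf G (S 0) (w 0) (w 1)) (w i) (w j) := by
  have h5 : ∀ i : Fin 19, (i : ℕ) < 5 → i ≠ 5 := by rintro _ h rfl; exact absurd h (by decide)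
  have h6 : ∀ i : Fin 19, (i : ℕ) < 5 → i ≠ 6 := by rintro _ h rfl; exact absurd h (by decide)
  have h18 : ∀ i : Fin 19, (i : ℕ) < 5 → i ≠ 18 := by rintro _ h rfl; exact absurd h (by decide)
  have t5 := fun w => realize_treeFormula (G := G) (S := S) (i := 5) (by decide) (w := w)
  have t6 := fun w => realize_treeFormula (G := G) (S := S) (i := 6) (by decide) (w := w)
  have t18 := fun w => realize_treeFormula (G := G) (S := S) (i := 18) (by decide) (w := w)
  have n1 : (5 : Fin 19) ≠ 6 := by decide
  have n2 : (5 : Fin 19) ≠ 18 := by decide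
  have n3 : (6 : Fin 19) ≠ 18 := by decide
  simp only [nxtFormula, FOFormula.Realize, realize_pathFormula (.inl (by omega : (i : ℕ) < 7)),
    realize_pathFormula (.inl (by omega : (j : ℕ) < 7)), t5, t6, t18, Function.update_self,
    Function.update_of_ne (h5 i hi),
    Function.update_of_ne (h5 j hj), Function.update_of_ne (h6 j hj),
    Function.update_of_ne (h18 j hj), Function.update_of_ne n1, Function.update_of_ne n2,
    Function.update_of_ne n3,
    Function.update_of_ne (h5 0 (by decide)), Function.update_of_ne (h5 1 (by decide)),
    Function.update_of_ne (h6 0 (by decide)), Function.update_of_ne (h6 1 (by decide)),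
    Function.update_of_ne (h18 0 (by decide)), Function.update_of_ne (h18 1 (by decide)),
    NxtOf, ne_eq]

/-- The values of variables 0 and 1 are parameters of the definitions, so `E` fixes them and only
the variables 2, 3, 4 may be requantified. -/
theorem interprets_oneSet (p₀ p₁ : V) : Interprets G S {w | w 0 = p₀ ∧ w 1 = p₁} {2, 3, 4}
    pathFormula treeFormula (FOFormula.eq · 0) nxtFormula (pathOf G (S 0) p₀ p₁)
    (S 0 \ pathOf G (S 0) p₀ p₁) p₀
    (NxtOf G (pathOf G (S 0) p₀ p₁) (S 0 \ pathOf G (S 0) p₀ p₁)) := by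
  have hA : ∀ i ∈ ({2, 3, 4} : Set (Fin 19)), (i : ℕ) < 5 ∧ i ≠ 0 ∧ i ≠ 1 := by
    rintro i (rfl | rfl | rfl) <;> decide
  constructor
  · rintro w ⟨h0, h1⟩ i hi b
    exact ⟨by rw [Function.update_of_ne (hA i hi).2.1.symm, h0],
      by rw [Function.update_of_ne (hA i hi).2.2.symm, h1]⟩
  · rintro w ⟨rfl, rfl⟩ i hi
    exact realize_pathFormula (.inl (by have := hA i hi; omega))
  · rintro w ⟨rfl, rfl⟩ i hi
    exact realize_treeFormula (.inl (by have := hA i hi; omega))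
  · rintro w ⟨rfl, rfl⟩ i hi
    exact Iff.rfl
  · rintro w ⟨rfl, rfl⟩ i hi j hj
    exact realize_nxtFormula (hA i hi).1 (hA j hj).1

theorem realize_fourChildrenFormula {p₀ p₁ : V} {w : Fin 19 → V} (hw : w 0 = p₀ ∧ w 1 = p₁)
    {P T : Set V} {N : V → V → Prop} (hP : P = pathOf G (S 0) p₀ p₁) (hT : T = S 0 \ P)
    (hN : N = NxtOf G P T) :
    fourChildrenFormula.Realize G S w ↔ ∀ t, t ∈ T → (∃ u v, G.Adj u t ∧ N u v) →
      ∃ c : Fin 4 → V, Function.Injective c ∧ ∀ s, IsChild G T N t s ↔ ∃ i, c i = s := by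
  subst hP hT hN
  have I := interprets_oneSet (G := G) (S := S) p₀ p₁
  have h2 : (2 : Fin 19) ∈ ({2, 3, 4} : Set (Fin 19)) := by simp
  have h3 : (3 : Fin 19) ∈ ({2, 3, 4} : Set (Fin 19)) := by simp
  have h4 : (4 : Fin 19) ∈ ({2, 3, 4} : Set (Fin 19)) := by simp
  have hc := fun w hw =>
    I.realize_child h2 h3 h4 (by decide) (by decide) (by decide) (w := w) hw
  simp only [fourChildrenFormula, FOFormula.Realize,
    FOFormula.realize_exs_ofFn childVars_injective, FOFormula.realize_distinct,
    childVars_injective.extend_apply]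
  refine forall_congr' fun t => ?_
  have hw2 := I.update w hw 2 h2 t
  rw [I.tree _ hw2 2 h2, Function.update_self]
  refine imp_congr_right fun _ => imp_congr ?_ ?_
  · refine exists_congr fun u => exists_congr fun v => ?_
    rw [I.nxt _ (I.update _ (I.update _ hw2 3 h3 u) 4 h4 v) 3 h3 4 h4]
    simp
  · refine exists_congr fun c => and_congr_right fun _ => forall_congr' fun s => ?_
    have hE : Function.extend childVars c (Function.update w 2 t) ∈
        {w : Fin 19 → V | w 0 = p₀ ∧ w 1 = p₁} := by
      simp only [Set.mem_ofPred_eq]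
      rw [extend_childVars (by decide), extend_childVars (by decide)]
      exact hw2
    rw [hc _ (I.update _ hE 3 h3 s), Function.update_self,
      Function.update_of_ne (by decide : (2 : Fin 19) ≠ 3), extend_childVars (by decide),
      Function.update_self, Function.update_of_ne (by decide : (14 : Fin 19) ≠ 3),
      Function.update_of_ne (by decide : (15 : Fin 19) ≠ 3),
      Function.update_of_ne (by decide : (16 : Fin 19) ≠ 3),
      Function.update_of_ne (by decide : (17 : Fin 19) ≠ 3),
      show (14 : Fin 19) = childVars 0 from rfl, show (15 : Fin 19) = childVars 1 from rfl,
      show (16 : Fin 19) = childVars 2 from rfl, show (17 : Fin 19) = childVars 3 from rfl]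
    simp only [childVars_injective.extend_apply, Fin.exists_fin_succ]
    simp

theorem realize_oneSetFormula {v : Fin 19 → V} : oneSetFormula.Realize G S v ↔
    ∃ p₀ p₁, p₀ ∈ S 0 ∧ p₁ ∈ S 0 ∧
      IsLayering G (pathOf G (S 0) p₀ p₁) (S 0 \ pathOf G (S 0) p₀ p₁) p₀
        (NxtOf G (pathOf G (S 0) p₀ p₁) (S 0 \ pathOf G (S 0) p₀ p₁)) ∧
      ∀ x, x ∈ S 0 ∨ ∃ y, y ∈ S 0 ∧ G.Adj x y := by
  rw [oneSetFormula]
  simp only [FOFormula.Realize]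
  refine exists_congr fun p₀ => exists_congr fun p₁ => ?_
  have hw : Function.update (Function.update v 0 p₀) 1 p₁ ∈
      {w : Fin 19 → V | w 0 = p₀ ∧ w 1 = p₁} := by simp
  rw [(interprets_oneSet p₀ p₁).realize_preLayering (by simp) (by simp) (by simp) (by decide)
    (by decide) (by decide) hw, realize_fourChildrenFormula hw rfl rfl rfl]
  simp only [Function.update_self, Function.update_of_ne (by decide : (2 : Fin 19) ≠ 3),
    Function.update_of_ne (by decide : (0 : Fin 19) ≠ 1)]
  exact ⟨fun ⟨h1, h2, h3, h4, h5⟩ => ⟨h1, h2, ⟨h3, h4⟩, h5⟩,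
    fun ⟨h1, h2, h3, h4⟩ => ⟨h1, h2, h3.1, h3.2, h4⟩⟩

/-- In the copy a tree vertex has at most one path neighbour, one parent and four children, so never
seven neighbours, whereas level `i ≥ 2` has at least sixteen tree vertices. The hypothesis on `j`
lets it be 1, or 0 when `a = 1`. -/
theorem pathOf_copy {a : ℕ+} (f : graphW a ↪g G) {j : Fin (a : ℕ)}
    (hj : ∀ i : Fin (a : ℕ), (i : ℕ) < 2 → (i : ℕ) = 0 ∨ i = j) :
    pathOf G (Set.range f) (f (.inl ⟨0, a.pos⟩)) (f (.inl j)) = Set.range fun i => f (.inl i) := by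
  ext x
  constructor
  · rintro ⟨⟨i | ⟨w, hw⟩, rfl⟩, h⟩
    · exact ⟨i, rfl⟩
    · exfalso
      rcases h with h | h | ⟨y, hy, hyX⟩
      · simpa using f.injective h
      · simpa using f.injective h
      · classical
        -- The six candidates for a neighbour: path vertex, parent, four children. Candidates
        -- falling outside the copy are replaced by `y 0`, which is harmless because only the bound
        -- on the number matters.
        have hsub : Finset.univ.image y ⊆ {f (.inl ⟨w.length, hw⟩)} ∪
            ({if h : w.tail.length < (a : ℕ) then f (.inr ⟨w.tail, h⟩) else y 0} ∪
            Finset.univ.image fun c : Fin 4 =>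
              if h : (c :: w).length < (a : ℕ) then f (.inr ⟨c :: w, h⟩) else y 0) := by
          intro v hv
          simp only [Finset.mem_image, Finset.mem_univ, true_and] at hv
          obtain ⟨t, rfl⟩ := hv
          obtain ⟨⟨u, hu⟩, hadj⟩ := hyX t
          rw [← hu, f.map_adj_iff] at hadj
          rw [← hu]
          simp only [Finset.mem_union, Finset.mem_singleton, Finset.mem_image, Finset.mem_univ,
            true_and]
          rcases u with i | ⟨w', hw'⟩
          · left
            simp only [graphW_adj_inr_inl] at hadj
            rw [show i = ⟨w.length, hw⟩ from Fin.ext hadj]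
          · right
            simp only [graphW_adj_inr_inr] at hadj
            rcases hadj with ⟨c, rfl⟩ | ⟨c, rfl⟩
            · right
              exact ⟨c, by rw [dif_pos hw']⟩
            · left
              have hw'' : (c :: w').tail.length < (a : ℕ) := hw'
              rw [dif_pos hw'']
              rfl
        have h1 := Finset.card_le_card hsub
        rw [Finset.card_image_of_injective _ hy] at h1
        have h2 := h1.trans (Finset.card_union_le _ _)
        have h3 := Finset.card_union_le
          ({if h : w.tail.length < (a : ℕ) then f (.inr ⟨w.tail, h⟩) else y 0} : Finset V)
          (Finset.univ.image fun c : Fin 4 =>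
              if h : (c :: w).length < (a : ℕ) then f (.inr ⟨c :: w, h⟩) else y 0)
        have h4 := Finset.card_image_le (s := Finset.univ) (f := fun c : Fin 4 =>
              if h : (c :: w).length < (a : ℕ) then f (.inr ⟨c :: w, h⟩) else y 0)
        simp only [Finset.card_univ, Fintype.card_fin, Finset.card_singleton] at h2 h3 h4
        omega
  · rintro ⟨i, rfl⟩
    refine ⟨⟨_, rfl⟩, ?_⟩
    by_cases hi : (i : ℕ) < 2
    · rcases hj i hi with h | rfl
      · left
        rw [show i = ⟨0, a.pos⟩ from Fin.ext h]
      · exact Or.inr (Or.inl rfl)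
    · right
      right
      -- Seven distinct words of length `i`: the first two letters are the base-four digits of `t`,
      -- the rest is padding.
      have hlen : ∀ t : Fin 7, (Fin.ofNat 4 (t / 4) :: Fin.ofNat 4 t ::
          List.replicate (i - 2) (0 : Fin 4)).length = i := by
        intro t
        simp
        omega
      refine ⟨fun t => f (.inr ⟨Fin.ofNat 4 (t / 4) :: Fin.ofNat 4 t ::
        List.replicate (i - 2) (0 : Fin 4), by rw [hlen]; exact i.2⟩), ?_, ?_⟩
      · intro s t hst
        have := f.injective hst
        simp only [Sum.inr.injEq, Subtype.mk.injEq, List.cons.injEq, and_true] at this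
        revert this
        revert s t
        simp only [Fin.ext_iff, Fin.ofNat]
        intro s t _ _
        omega
      · intro t
        refine ⟨⟨_, rfl⟩, ?_⟩
        rw [f.map_adj_iff, graphW_adj_inl_inr]
        exact (hlen t).symm

/-- The branching orients the path: a tree vertex has several neighbours on the level below it but
only one, its parent, on the level above. -/
theorem nxtOf_copy {a : ℕ+} (f : graphW a ↪g G) :
    NxtOf G (Set.range fun i => f (.inl i)) (Set.range fun w => f (.inr w)) = copyNxt f := by
  ext x y
  constructor
  · rintro ⟨⟨i, rfl⟩, ⟨j, rfl⟩, hij, _, ⟨t, rfl⟩, hit, _, ⟨s, rfl⟩, hts, hjs, _, ⟨s', rfl⟩, hts',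
      hjs', hne⟩
    rw [copyNxt_iff]
    simp only [f.map_adj_iff, graphW_adj_inl_inl, graphW_adj_inl_inr, graphW_adj_inr_inr]
      at hij hit hts hjs hts' hjs'
    refine hij.resolve_right fun hji => hne ?_
    have key : ∀ s : {w : List (Fin 4) // w.length < (a : ℕ)}, (j : ℕ) = s.1.length →
        ((∃ c, s.1 = c :: t.1) ∨ ∃ c, t.1 = c :: s.1) → s.1 = t.1.tail := by
      rintro s hs (⟨c, hc⟩ | ⟨c, hc⟩)
      · rw [hc, List.length_cons] at hs
        omega
      · rw [hc, List.tail_cons]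
    rw [show s = s' from Subtype.ext ((key s hjs hts).trans (key s' hjs' hts').symm)]
  · rintro ⟨i, j, hij, rfl, rfl⟩
    have hj := j.2
    refine ⟨⟨i, rfl⟩, ⟨j, rfl⟩, by simp [hij], _, ⟨⟨List.replicate i 0, by simp⟩, rfl⟩, by simp,
      _, ⟨⟨0 :: List.replicate i 0, by simp; omega⟩, rfl⟩, by simp, by simp [hij],
      _, ⟨⟨1 :: List.replicate i 0, by simp; omega⟩, rfl⟩, by simp, by simp [hij], ?_⟩
    intro h
    simpa using f.injective h

theorem oneSet_models_iff [Finite V] [Nonempty V] (G : SimpleGraph V) :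
    oneSetFormula.toSentence.Models G ↔ ∃ a : ℕ+, HasInducedDominatingCopy (graphW a) G := by
  rw [FOFormula.models_toSentence fun S v => realize_oneSetFormula]
  constructor
  · rintro ⟨S, p₀, p₁, h0, h1, h, hdom⟩
    obtain ⟨a, f, hf⟩ := h.exists_embedding
    rw [Set.union_sdiff_cancel (fun x hx => hx.1)] at hf
    refine ⟨a, f, fun x hx => ?_⟩
    obtain ⟨y, hy, hxy⟩ := (hdom x).resolve_left (hf ▸ hx)
    rw [← hf] at hy
    obtain ⟨u, rfl⟩ := hy
    exact ⟨u, hxy⟩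
  · rintro ⟨a, f, hdom⟩
    -- For `a = 1` there is no second path vertex and the first one is taken twice.
    obtain ⟨j, hj⟩ : ∃ j : Fin (a : ℕ),
        ∀ i : Fin (a : ℕ), (i : ℕ) < 2 → (i : ℕ) = 0 ∨ i = j := by
      by_cases ha : 1 < (a : ℕ)
      · exact ⟨⟨1, ha⟩, fun i hi => by rw [Fin.ext_iff]; dsimp only; omega⟩
      · exact ⟨⟨0, a.pos⟩, fun i hi => by omega⟩
    have hP := pathOf_copy f hj
    have hT : Set.range f \ Set.range (fun i => f (.inl i)) = Set.range fun w => f (.inr w) := by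
      rw [range_copy, Set.union_sdiff_left]
      refine sdiff_eq_left.2 (Set.disjoint_left.2 fun x hx hx' => ?_)
      exact (isLayering_copy f).notMem_tree x hx' hx
    refine ⟨fun _ => Set.range f, f (.inl ⟨0, a.pos⟩), f (.inl j), ⟨_, rfl⟩, ⟨_, rfl⟩, ?_, ?_⟩
    · rw [hP, hT, nxtOf_copy]
      exact isLayering_copy f
    · intro x
      by_cases hx : x ∈ Set.range f
      · exact Or.inl hx
      · obtain ⟨u, hu⟩ := hdom x hx
        exact Or.inr ⟨f u, ⟨u, rfl⟩, hu⟩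

end OneSet

end EMSOGraph

namespace EMSOGraph

/-! ### The sentence with three first-order variables

The monadic variables `0`, `1`, `2` are the residue classes modulo three of the path, `3` is the
tree, `4` contains just the first vertex of the path, and `5`, …, `8` number the children. -/

section ThreeVariables
variable {V : Type*} {G : SimpleGraph V}

/-- The formula saying that a variable lies on the path. -/
def pathFormula₃ (i : Fin 3) : FOFormula 9 3 :=
  (FOFormula.mem 0 i).or ((FOFormula.mem 1 i).or (.mem 2 i))

/-- The formula saying that the second variable follows the first one on the path. -/
def nxtFormula₃ (i j : Fin 3) : FOFormula 9 3 :=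
  (FOFormula.adj i j).and (((FOFormula.mem 0 i).and (.mem 1 j)).or
    (((FOFormula.mem 1 i).and (.mem 2 j)).or ((FOFormula.mem 2 i).and (.mem 0 j))))

/-- The monadic variable for the children with number `c`. -/
def childSet (c : Fin 4) : Fin 9 := ⟨c + 5, by omega⟩

/-- The formula saying that each tree vertex which is not on the last level has exactly one child
of each number. -/
def fourChildrenFormula₃ : FOFormula 9 3 :=
  (FOFormula.all 0 (.conj ((List.finRange 4).map fun c => .conj (((List.finRange 4).filter
    (c ≠ ·)).map fun d => ((FOFormula.mem (childSet c) 0).and (.mem (childSet d) 0)).neg)))).and <|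
  (FOFormula.all 0 (.all 1 ((childFormula (.mem 3) nxtFormula₃ 0 1 2).imp
    ((FOFormula.mem 5 1).or ((FOFormula.mem 6 1).or ((FOFormula.mem 7 1).or (.mem 8 1))))))).and <|
  (FOFormula.conj ((List.finRange 4).map fun c => .all 0 (.all 1 (.all 2
    ((childFormula (.mem 3) nxtFormula₃ 0 1 2).imp ((childFormula (.mem 3) nxtFormula₃ 0 2 1).imp
      ((FOFormula.mem (childSet c) 1).imp
        ((FOFormula.mem (childSet c) 2).imp (.eq 1 2))))))))).and <|
  FOFormula.conj ((List.finRange 4).map fun c => .all 0 ((FOFormula.mem 3 0).imp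
    ((FOFormula.ex 1 (.ex 2 ((FOFormula.adj 1 0).and (nxtFormula₃ 1 2)))).imp
      (.ex 1 ((FOFormula.mem (childSet c) 1).and (childFormula (.mem 3) nxtFormula₃ 0 1 2))))))

/-- The first-order part of the sentence with three first-order variables. -/
def threeVariableFormula : FOFormula 9 3 :=
  (FOFormula.ex 0 (.mem 4 0)).and <|
  (FOFormula.all 0 (.all 1 ((FOFormula.mem 4 0).imp ((FOFormula.mem 4 1).imp (.eq 0 1))))).and <|
  (preLayeringFormula pathFormula₃ (.mem 3) (.mem 4) nxtFormula₃ 0 1 2).and <|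
  fourChildrenFormula₃.and <|
  .all 0 (((pathFormula₃ 0).or (.mem 3 0)).or
    (.ex 1 (((pathFormula₃ 1).or (.mem 3 1)).and (.adj 0 1))))

variable (G) in
/-- The successor relation defined by `nxtFormula₃`. -/
def nxtMod (S : Fin 9 → Set V) (u v : V) : Prop :=
  G.Adj u v ∧ (u ∈ S 0 ∧ v ∈ S 1 ∨ u ∈ S 1 ∧ v ∈ S 2 ∨ u ∈ S 2 ∧ v ∈ S 0)

variable {S : Fin 9 → Set V}

theorem interprets_threeVariables {r : V} (hr : ∀ x, x ∈ S 4 ↔ x = r) :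
    Interprets G S Set.univ Set.univ pathFormula₃ (.mem 3) (.mem 4) nxtFormula₃
      (S 0 ∪ (S 1 ∪ S 2)) (S 3) r (nxtMod G S) :=
  ⟨by simp, fun _ _ _ _ => Iff.rfl, fun _ _ _ _ => Iff.rfl, fun _ _ _ _ => hr _,
    fun _ _ _ _ _ _ => Iff.rfl⟩

theorem realize_fourChildrenFormula₃ {r : V} (hr : ∀ x, x ∈ S 4 ↔ x = r) {w : Fin 3 → V} :
    fourChildrenFormula₃.Realize G S w ↔
      (∀ x c d, c ≠ d → ¬ (x ∈ S (childSet c) ∧ x ∈ S (childSet d))) ∧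
      (∀ t s, IsChild G (S 3) (nxtMod G S) t s → ∃ c, s ∈ S (childSet c)) ∧
      (∀ c t s s', IsChild G (S 3) (nxtMod G S) t s → IsChild G (S 3) (nxtMod G S) t s' →
        s ∈ S (childSet c) → s' ∈ S (childSet c) → s = s') ∧
      ∀ c t, t ∈ S 3 → (∃ u v, G.Adj u t ∧ nxtMod G S u v) →
        ∃ s, s ∈ S (childSet c) ∧ IsChild G (S 3) (nxtMod G S) t s := by
  have I := interprets_threeVariables (G := G) hr
  have c1 := fun w => I.realize_child (x := 0) (y := 1) (z := 2) trivial trivial trivial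
    (by decide) (by decide) (by decide) (w := w) trivial
  have c2 := fun w => I.realize_child (x := 0) (y := 2) (z := 1) trivial trivial trivial
    (by decide) (by decide) (by decide) (w := w) trivial
  have c3 := fun w => I.nxt w trivial 1 trivial 2 trivial
  simp only [fourChildrenFormula₃, FOFormula.Realize, FOFormula.realize_conj, List.mem_map,
    List.mem_finRange, true_and, forall_exists_index, forall_apply_eq_imp_iff, List.mem_filter,
    decide_eq_true_eq, and_imp, forall_apply_eq_imp_iff₂, c1, c2, c3, Function.update_self,
    Function.update_of_ne (by decide : (0 : Fin 3) ≠ 1),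
    Function.update_of_ne (by decide : (0 : Fin 3) ≠ 2),
    Function.update_of_ne (by decide : (1 : Fin 3) ≠ 2)]
  refine and_congr Iff.rfl (and_congr ?_ Iff.rfl)
  refine forall₂_congr fun t s => imp_congr_right fun _ => ?_
  simp only [Fin.exists_fin_succ]
  simp [childSet]

theorem realize_threeVariableFormula {v : Fin 3 → V} : threeVariableFormula.Realize G S v ↔
    ∃ r, (∀ x, x ∈ S 4 ↔ x = r) ∧
      IsPreLayering G (S 0 ∪ (S 1 ∪ S 2)) (S 3) r (nxtMod G S) ∧
      ((∀ x c d, c ≠ d → ¬ (x ∈ S (childSet c) ∧ x ∈ S (childSet d))) ∧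
      (∀ t s, IsChild G (S 3) (nxtMod G S) t s → ∃ c, s ∈ S (childSet c)) ∧
      (∀ c t s s', IsChild G (S 3) (nxtMod G S) t s → IsChild G (S 3) (nxtMod G S) t s' →
        s ∈ S (childSet c) → s' ∈ S (childSet c) → s = s') ∧
      ∀ c t, t ∈ S 3 → (∃ u v, G.Adj u t ∧ nxtMod G S u v) →
        ∃ s, s ∈ S (childSet c) ∧ IsChild G (S 3) (nxtMod G S) t s) ∧
      ∀ x, x ∈ (S 0 ∪ (S 1 ∪ S 2)) ∪ S 3 ∨ ∃ y, y ∈ (S 0 ∪ (S 1 ∪ S 2)) ∪ S 3 ∧ G.Adj x y := by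
  have key : ∀ r, (∀ x, x ∈ S 4 ↔ x = r) → (((preLayeringFormula pathFormula₃ (.mem 3) (.mem 4)
      nxtFormula₃ 0 1 2).Realize G S v ↔ _) ∧ (fourChildrenFormula₃.Realize G S v ↔ _)) :=
    fun r hr => ⟨(interprets_threeVariables (G := G) hr).realize_preLayering trivial trivial trivial
      (by decide) (by decide) (by decide) trivial, realize_fourChildrenFormula₃ hr⟩
  have hdom : (FOFormula.all 0 (((pathFormula₃ 0).or (.mem 3 0)).or
      (.ex 1 (((pathFormula₃ 1).or (.mem 3 1)).and (.adj 0 1))))).Realize G S v ↔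
      ∀ x, x ∈ (S 0 ∪ (S 1 ∪ S 2)) ∪ S 3 ∨ ∃ y, y ∈ (S 0 ∪ (S 1 ∪ S 2)) ∪ S 3 ∧ G.Adj x y :=
    Iff.rfl
  constructor
  · rintro ⟨⟨r, hr⟩, huniq, h1, h2, h3⟩
    have hr' : ∀ x, x ∈ S 4 ↔ x = r :=
      fun x => ⟨fun hx => huniq x r hx hr, by rintro rfl; exact hr⟩
    exact ⟨r, hr', (key r hr').1.1 h1, (key r hr').2.1 h2, hdom.1 h3⟩
  · rintro ⟨r, hr, h1, h2, h3⟩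
    exact ⟨⟨r, (hr r).2 rfl⟩, fun x y hx hy => ((hr x).1 hx).trans ((hr y).1 hy).symm,
      (key r hr).1.2 h1, (key r hr).2.2 h2, hdom.2 h3⟩

/-- The monadic variables describing a copy of `W_a`. -/
def copySets {a : ℕ+} (f : graphW a ↪g G) (s : Fin 9) : Set V :=
  if (s : ℕ) < 3 then {x | ∃ i : Fin (a : ℕ), (i : ℕ) % 3 = s ∧ f (.inl i) = x}
  else if s = 3 then Set.range fun w => f (.inr w)
  else if s = 4 then {f (.inl ⟨0, a.pos⟩)}
  else {x | ∃ w : {w : List (Fin 4) // w.length < (a : ℕ)},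
    ∃ (c : Fin 4) (u : List (Fin 4)), (c : ℕ) + 5 = s ∧ w.1 = c :: u ∧ f (.inr w) = x}

theorem copySets_childSet {a : ℕ+} (f : graphW a ↪g G) (c : Fin 4) : copySets f (childSet c) =
    {x | ∃ w : {w : List (Fin 4) // w.length < (a : ℕ)}, ∃ u, w.1 = c :: u ∧ f (.inr w) = x} := by
  rw [copySets, if_neg (by simp [childSet]), if_neg (by simp [childSet, Fin.ext_iff]),
    if_neg (by simp [childSet, Fin.ext_iff])]
  ext x
  simp only [Set.mem_ofPred_eq, childSet, Nat.add_right_cancel_iff, ← Fin.ext_iff]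
  constructor
  · rintro ⟨w, _, u, rfl, h⟩
    exact ⟨w, u, h⟩
  · rintro ⟨w, u, h⟩
    exact ⟨w, c, u, rfl, h⟩

theorem copySets_path {a : ℕ+} (f : graphW a ↪g G) :
    copySets f 0 ∪ (copySets f 1 ∪ copySets f 2) = Set.range fun i => f (.inl i) := by
  ext x
  simp only [copySets, Set.mem_union, Set.mem_range]
  simp only [Fin.coe_ofNat_eq_mod, Nat.reduceMod, Nat.reduceLT, if_true, Set.mem_ofPred_eq,
    ← exists_or, ← or_and_right]
  refine exists_congr fun i => and_iff_right ?_
  omega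

/-- Adjacent path indices differ by one, and their residues modulo three tell which is larger;
residues modulo two would not. -/
theorem nxtMod_copySets {a : ℕ+} (f : graphW a ↪g G) : nxtMod G (copySets f) = copyNxt f := by
  ext x y
  have key : ∀ (s : Fin 9), (s : ℕ) < 3 → ∀ x, x ∈ copySets f s ↔
      ∃ i : Fin (a : ℕ), (i : ℕ) % 3 = s ∧ f (.inl i) = x := by
    intro s hs x
    rw [copySets, if_pos hs]
    rfl
  rw [nxtMod, key 0 (by decide), key 1 (by decide), key 2 (by decide), key 0 (by decide),
    key 1 (by decide), key 2 (by decide)]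
  constructor
  · rintro ⟨hadj, ⟨⟨i, hi, rfl⟩, j, hj, rfl⟩ | ⟨⟨i, hi, rfl⟩, j, hj, rfl⟩ |
      ⟨⟨i, hi, rfl⟩, j, hj, rfl⟩⟩ <;>
    · rw [f.map_adj_iff, graphW_adj_inl_inl] at hadj
      rw [copyNxt_iff]
      simp at hi hj
      omega
  · rintro ⟨i, j, hij, rfl, rfl⟩
    refine ⟨by simp [hij], ?_⟩
    have : (i : ℕ) % 3 = 0 ∧ (j : ℕ) % 3 = 1 ∨ (i : ℕ) % 3 = 1 ∧ (j : ℕ) % 3 = 2 ∨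
      (i : ℕ) % 3 = 2 ∧ (j : ℕ) % 3 = 0 := by omega
    exact this.imp (fun h => ⟨⟨i, h.1, rfl⟩, j, h.2, rfl⟩) (Or.imp
      (fun h => ⟨⟨i, h.1, rfl⟩, j, h.2, rfl⟩) (fun h => ⟨⟨i, h.1, rfl⟩, j, h.2, rfl⟩))

/-- Having exactly one child of each of four numbers expresses "exactly four children" without four
simultaneous first-order variables. In a copy, a child is numbered by the first letter of its word.
-/
theorem threeVariables_models_iff [Finite V] [Nonempty V] (G : SimpleGraph V) :
    threeVariableFormula.toSentence.Models G ↔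
      ∃ a : ℕ+, HasInducedDominatingCopy (graphW a) G := by
  rw [FOFormula.models_toSentence fun S v => realize_threeVariableFormula]
  constructor
  · rintro ⟨S, r, hr, hpre, ⟨hdisj, hnum, huniq, hex⟩, hdom⟩
    have h : IsLayering G (S 0 ∪ (S 1 ∪ S 2)) (S 3) r (nxtMod G S) := by
      refine ⟨hpre, fun t ht htu => ?_⟩
      choose c hcS hc using fun i => hex i t ht htu
      refine ⟨c, fun i j hij => ?_, fun s => ⟨fun hs => ?_, ?_⟩⟩
      · exact by_contra fun hne => hdisj (c i) i j hne ⟨hcS i, hij ▸ hcS j⟩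
      · obtain ⟨i, hi⟩ := hnum t s hs
        exact ⟨i, huniq i t _ _ (hc i) hs (hcS i) hi⟩
      · rintro ⟨i, rfl⟩
        exact hc i
    obtain ⟨a, f, hf⟩ := h.exists_embedding
    refine ⟨a, f, fun x hx => ?_⟩
    obtain ⟨y, hy, hxy⟩ := (hdom x).resolve_left (hf ▸ hx)
    rw [← hf] at hy
    obtain ⟨u, rfl⟩ := hy
    exact ⟨u, hxy⟩
  · rintro ⟨a, f, hdom⟩
    have h3 : copySets f 3 = Set.range fun w => f (.inr w) := rfl
    refine ⟨copySets f, f (.inl ⟨0, a.pos⟩), fun x => Iff.rfl, ?_, ?_, ?_⟩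
    · rw [copySets_path, nxtMod_copySets, h3]
      exact (isLayering_copy f).toIsPreLayering
    · simp only [nxtMod_copySets, h3, copySets_childSet, isChild_copy_iff]
      refine ⟨?_, ?_, ?_, ?_⟩
      · rintro _ c d hcd ⟨⟨w, u, hw, rfl⟩, w', u', hw', h⟩
        obtain rfl : w' = w := by simpa using f.injective h
        rw [hw, List.cons.injEq] at hw'
        exact hcd hw'.1
      · rintro _ _ ⟨w, w', ⟨c, hc⟩, rfl, rfl⟩
        exact ⟨c, w', w.1, hc, rfl⟩
      · rintro c _ _ _ ⟨w, w', ⟨d, hd⟩, rfl, rfl⟩ ⟨v, v', ⟨e, he⟩, hv, rfl⟩ ⟨x, u, hx, hx'⟩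
          ⟨y, u', hy, hy'⟩
        obtain rfl : v = w := by simpa using f.injective hv
        obtain rfl : x = w' := by simpa using f.injective hx'
        obtain rfl : y = v' := by simpa using f.injective hy'
        rw [hx, List.cons.injEq] at hd
        rw [hy, List.cons.injEq] at he
        rw [show x = y from Subtype.ext (by rw [hx, hy, hd.2, he.2])]
      · rintro c _ ⟨w, rfl⟩ ⟨_, _, hadj, i, j, hij, rfl, rfl⟩
        rw [f.map_adj_iff, graphW_adj_inl_inr] at hadj
        have hlen : (c :: w.1).length < (a : ℕ) := by
          rw [List.length_cons]
          omega
        exact ⟨_, ⟨⟨c :: w.1, hlen⟩, _, rfl, rfl⟩, w, ⟨c :: w.1, hlen⟩, ⟨c, rfl⟩, rfl, rfl⟩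
    · rw [copySets_path, h3, ← range_copy]
      intro x
      by_cases hx : x ∈ Set.range f
      · exact Or.inl hx
      · obtain ⟨u, hu⟩ := hdom x hx
        exact Or.inr ⟨f u, ⟨u, rfl⟩, hu⟩

end ThreeVariables

end EMSOGraph

namespace EMSOGraph

open MeasureTheory

/-! ### Finite probability spaces -/

section FiniteProbability
variable {Ω : Type*} [MeasurableSpace Ω] [DiscreteMeasurableSpace Ω] {μ : Measure Ω}
  [IsProbabilityMeasure μ]

theorem measureReal_eq_sum_indicator [Fintype Ω] (A : Set Ω) :
    μ.real A = ∑ ω, μ.real {ω} * A.indicator 1 ω := by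
  classical
  have h := sum_measureReal_singleton (μ := μ) A.toFinset
  rw [Set.coe_toFinset] at h
  rw [← h, ← Finset.sum_filter_add_sum_filter_not Finset.univ (· ∈ A)]
  rw [Finset.sum_eq_zero (s := Finset.univ.filter (· ∉ A)), add_zero]
  · refine Finset.sum_congr (by ext; simp) fun ω hω => ?_
    rw [Finset.mem_filter] at hω
    simp [hω.2]
  · intro ω hω
    rw [Finset.mem_filter] at hω
    simp [hω.2]

/-- The Chung–Erdős inequality. -/
theorem sq_sum_measureReal_le [Finite Ω] {ι : Type*} (s : Finset ι) (A : ι → Set Ω) :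
    (∑ i ∈ s, μ.real (A i)) ^ 2 ≤
      μ.real (⋃ i ∈ s, A i) * ∑ i ∈ s, ∑ j ∈ s, μ.real (A i ∩ A j) := by
  have := Fintype.ofFinite Ω
  let U : Set Ω := ⋃ i ∈ s, A i
  let X : Ω → ℝ := fun ω => ∑ i ∈ s, (A i).indicator 1 ω
  have hX : ∀ ω, U.indicator 1 ω * X ω = X ω := by
    intro ω
    by_cases hω : ω ∈ U
    · simp [hω]
    · have : X ω = 0 := Finset.sum_eq_zero fun i hi => Set.indicator_of_notMem
        (fun h => hω (Set.mem_biUnion hi h)) _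
      rw [this, mul_zero]
  have hsq : ∀ ω, √(μ.real {ω}) ^ 2 = μ.real {ω} := fun ω => Real.sq_sqrt measureReal_nonneg
  -- Cauchy–Schwarz for the indicator of the union and the number `X` of events that occur; the
  -- square roots distribute the weight of each outcome over the two factors.
  have key := Finset.sum_mul_sq_le_sq_mul_sq Finset.univ
    (fun ω => √(μ.real {ω}) * U.indicator 1 ω) (fun ω => √(μ.real {ω}) * X ω)
  have h1 : ∑ ω, √(μ.real {ω}) * U.indicator 1 ω * (√(μ.real {ω}) * X ω) =
      ∑ i ∈ s, μ.real (A i) := by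
    simp only [fun i => measureReal_eq_sum_indicator (μ := μ) (A i)]
    rw [Finset.sum_comm]
    refine Finset.sum_congr rfl fun ω _ => ?_
    rw [← Finset.mul_sum]
    calc _ = √(μ.real {ω}) ^ 2 * (U.indicator 1 ω * X ω) := by ring
      _ = _ := by rw [hX, hsq]
  have h2 : ∑ ω, (√(μ.real {ω}) * U.indicator 1 ω) ^ 2 = μ.real U := by
    rw [measureReal_eq_sum_indicator (μ := μ) U]
    refine Finset.sum_congr rfl fun ω _ => ?_
    rw [mul_pow, hsq]
    by_cases hω : ω ∈ U <;> simp [hω]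
  have h3 : ∑ ω, (√(μ.real {ω}) * X ω) ^ 2 = ∑ i ∈ s, ∑ j ∈ s, μ.real (A i ∩ A j) := by
    simp only [fun i j => measureReal_eq_sum_indicator (μ := μ) (A i ∩ A j)]
    rw [Finset.sum_congr rfl fun i _ => Finset.sum_comm, Finset.sum_comm]
    refine Finset.sum_congr rfl fun ω _ => ?_
    rw [mul_pow, hsq, sq, Finset.sum_mul_sum, Finset.mul_sum]
    refine Finset.sum_congr rfl fun i _ => ?_
    rw [Finset.mul_sum]
    refine Finset.sum_congr rfl fun j _ => ?_
    rw [Set.inter_indicator_one]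
    rfl
  rwa [h1, h2, h3] at key

/-- If the events `B v` are independent of probability `x`, so are their complements. -/
theorem measureReal_forall_not_mem {ι : Type*} [DecidableEq ι] {B : ι → Set Ω} {x : ℝ}
    {r : Finset ι} (hB : ∀ t ⊆ r, μ.real {ω | ∀ v ∈ t, ω ∈ B v} = x ^ t.card) {s : Finset ι}
    (hs : s ⊆ r) : μ.real {ω | ∀ v ∈ s, ω ∉ B v} = (1 - x) ^ s.card := by
  -- The induction needs the mixed statement: moving one index `v` out of the complemented set
  -- splits an event into its parts inside and outside `B v`.
  have key : ∀ s ⊆ r, ∀ t ⊆ r, Disjoint s t →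
      μ.real {ω | (∀ v ∈ t, ω ∈ B v) ∧ ∀ v ∈ s, ω ∉ B v} = x ^ t.card * (1 - x) ^ s.card := by
    intro s
    induction s using Finset.induction_on with
    | empty =>
      intro _ t ht _
      simp [hB t ht]
    | insert v s hv ih =>
      intro hs t ht hst
      rw [Finset.disjoint_insert_left] at hst
      have hs' := (Finset.subset_insert v s).trans hs
      have h1 := ih hs' t ht hst.2
      have h2 := ih hs' (insert v t)
        (Finset.insert_subset (hs (Finset.mem_insert_self v s)) ht)
        (Finset.disjoint_insert_right.2 ⟨hv, hst.2⟩)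
      have h3 := measureReal_inter_add_sdiff (μ := μ)
        (s := {ω | (∀ v ∈ t, ω ∈ B v) ∧ ∀ v ∈ s, ω ∉ B v}) (t := B v)
        (MeasurableSet.of_discrete)
      have e1 : {ω | (∀ v ∈ t, ω ∈ B v) ∧ ∀ v ∈ s, ω ∉ B v} ∩ B v =
          {ω | (∀ u ∈ insert v t, ω ∈ B u) ∧ ∀ v ∈ s, ω ∉ B v} := by
        ext ω
        simp only [Set.mem_inter_iff, Set.mem_ofPred_eq, Finset.forall_mem_insert]
        tauto
      have e2 : {ω | (∀ v ∈ t, ω ∈ B v) ∧ ∀ v ∈ s, ω ∉ B v} \ B v =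
          {ω | (∀ v ∈ t, ω ∈ B v) ∧ ∀ u ∈ insert v s, ω ∉ B u} := by
        ext ω
        simp only [Set.mem_sdiff, Set.mem_ofPred_eq, Finset.forall_mem_insert]
        tauto
      rw [e1, e2, h1, h2, Finset.card_insert_of_notMem hst.1] at h3
      rw [Finset.card_insert_of_notMem hv]
      linear_combination h3
  have := key s hs ∅ (by simp) (by simp)
  simpa using this

end FiniteProbability

/-! ### Events in the binomial random graph -/

section BinomialRandom
variable {V : Type*} [Finite V] {p : unitInterval}

instance : DiscreteMeasurableSpace (SimpleGraph V) := by
  have : MeasurableSingletonClass (SimpleGraph V) := ⟨fun G => by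
    have : ({G} : Set (SimpleGraph V)) = SimpleGraph.edgeSet ⁻¹' {G.edgeSet} := by
      ext G'
      simp
    rw [this]
    exact SimpleGraph.measurable_edgeSet (measurableSet_singleton _)⟩
  infer_instance

open Classical in
/-- The probability of prescribing the adjacency of finitely many pairs. -/
theorem binomialRandom_real_prescribed (E : Finset (Sym2 V)) (hE : ∀ e ∈ E, ¬ e.IsDiag)
    (s : Set (Sym2 V)) :
    (SimpleGraph.binomialRandom V p).real {G | ∀ e ∈ E, e ∈ G.edgeSet ↔ e ∈ s} =
      ∏ e ∈ E, if e ∈ s then (p : ℝ) else 1 - p := by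
  have hm : Measurable fun q : Sym2 V → Prop => {i | q i} := MeasurableEquiv.setOfPred.measurable
  rw [measureReal_def, SimpleGraph.binomialRandom_eq_map, ProbabilityTheory.setBernoulli_eq_map,
    Measure.map_apply (by fun_prop) (.of_discrete),
    Measure.map_apply hm (.of_discrete)]
  -- The event is a box in the product space of independent pair indicators. Since `fromEdgeSet`
  -- discards loops, this needs `E` to contain no diagonal pair.
  have : (fun q : Sym2 V → Prop => {i | q i}) ⁻¹' (SimpleGraph.fromEdgeSet ⁻¹'
      {G | ∀ e ∈ E, e ∈ G.edgeSet ↔ e ∈ s}) = Set.pi E fun e => {b | b ↔ e ∈ s} := by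
    ext q
    simp only [Set.mem_preimage, Set.mem_ofPred_eq, Set.mem_pi, Finset.mem_coe,
      SimpleGraph.edgeSet_fromEdgeSet]
    refine forall₂_congr fun e he => ?_
    simp [hE e he]
  rw [this, Measure.infinitePi_pi _ (fun _ _ => .of_discrete), ENNReal.toReal_prod]
  refine Finset.prod_congr rfl fun e he => ?_
  have hd := hE e he
  split_ifs with h <;> simp [h, hd, Set.indicator]

end BinomialRandom

end EMSOGraph

namespace EMSOGraph

open MeasureTheory

/-! ### Edge weights -/

section Weights
open Classical
variable {U : Type*}

/-- The pairs of distinct elements of `I`. -/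
noncomputable def pairs (I : Finset U) : Finset (Sym2 U) := I.offDiag.image Sym2.mk.uncurry

theorem mk_mem_pairs {I : Finset U} {x y : U} : s(x, y) ∈ pairs I ↔ x ∈ I ∧ y ∈ I ∧ x ≠ y := by
  simp only [pairs, Finset.mem_image, Finset.mem_offDiag, Prod.exists, Function.uncurry_apply_pair,
    Sym2.eq_iff]
  constructor
  · rintro ⟨a, b, ⟨ha, hb, hab⟩, ⟨rfl, rfl⟩ | ⟨rfl, rfl⟩⟩
    · exact ⟨ha, hb, hab⟩
    · exact ⟨hb, ha, hab.symm⟩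
  · exact fun h => ⟨x, y, h, Or.inl ⟨rfl, rfl⟩⟩

theorem two_mul_card_pairs (I : Finset U) : 2 * (pairs I).card = I.card * (I.card - 1) := by
  rw [pairs, Sym2.two_mul_card_image_offDiag, Finset.offDiag_card, Nat.mul_sub_one]

theorem pairs_mono {I J : Finset U} (h : I ⊆ J) : pairs I ⊆ pairs J :=
  Finset.image_subset_image (Finset.offDiag_mono h)

/-- The probability that a pair is as in `H`. -/
noncomputable def pairWeight (H : SimpleGraph U) (p : unitInterval) (e : Sym2 U) : ℝ :=
  if e ∈ H.edgeSet then (p : ℝ) else 1 - p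

/-- The edges of `H` can be oriented with out-degrees at most two. -/
def HasOrientation (H : SimpleGraph U) : Prop :=
  ∃ o : Fin 2 → U → U, ∀ u v, H.Adj u v → ∃ j, v = o j u ∨ u = o j v

variable {H : SimpleGraph U} {p : unitInterval}

/-- Each edge inside `I` is determined by its tail in `I` and one of two out-going choices. -/
theorem HasOrientation.card_edges_le (hH : HasOrientation H) (I : Finset U) :
    ((pairs I).filter (· ∈ H.edgeSet)).card ≤ 2 * I.card := by
  obtain ⟨o, ho⟩ := hH
  calc ((pairs I).filter (· ∈ H.edgeSet)).card
      ≤ (((Finset.univ : Finset (Fin 2)) ×ˢ I).image fun x => s(x.2, o x.1 x.2)).card := by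
        refine Finset.card_le_card fun e he => ?_
        rw [Finset.mem_filter] at he
        induction e using Sym2.ind with
        | _ u v =>
          rw [mk_mem_pairs, SimpleGraph.mem_edgeSet] at he
          obtain ⟨j, hj | hj⟩ := ho u v he.2
          · exact Finset.mem_image.2 ⟨(j, u), by simp [he.1.1], by rw [hj]⟩
          · exact Finset.mem_image.2 ⟨(j, v), by simp [he.1.2.1], by rw [hj, Sym2.eq_swap]⟩
    _ ≤ _ := Finset.card_image_le
    _ = _ := by simp [Finset.card_product]

theorem pairWeight_nonneg (e : Sym2 U) : 0 ≤ pairWeight H p e := by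
  rw [pairWeight]
  split_ifs
  · exact p.2.1
  · exact sub_nonneg.2 p.2.2

theorem pairWeight_pos (hp0 : 0 < p) (hp1 : p < 1) (e : Sym2 U) : 0 < pairWeight H p e := by
  rw [pairWeight]
  split_ifs
  · exact hp0
  · exact sub_pos.2 hp1

/-- Compared with all pairs being non-edges, only the at most `2|I|` edges need correction; for
these `(1 - p) * p ≤ p`. It serves as a lower bound on the weight of the overlap of two copies. -/
theorem le_prod_pairWeight (hH : HasOrientation H) (I : Finset U) :
    (1 - p : ℝ) ^ (pairs I).card * (p : ℝ) ^ (2 * I.card) ≤ ∏ e ∈ pairs I, pairWeight H p e := by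
  have hp0' : (0 : ℝ) ≤ p := p.2.1
  have hp1' : (p : ℝ) ≤ 1 := p.2.2
  calc (1 - p : ℝ) ^ (pairs I).card * (p : ℝ) ^ (2 * I.card)
      ≤ (1 - p : ℝ) ^ (pairs I).card * (p : ℝ) ^ ((pairs I).filter (· ∈ H.edgeSet)).card := by
        refine mul_le_mul_of_nonneg_left ?_ (pow_nonneg (by linarith) _)
        exact pow_le_pow_of_le_one hp0' hp1' (hH.card_edges_le I)
    _ = ∏ e ∈ pairs I, (1 - p : ℝ) * if e ∈ H.edgeSet then (p : ℝ) else 1 := by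
        rw [Finset.prod_mul_distrib, Finset.prod_const, Finset.prod_ite, Finset.prod_const,
          Finset.prod_const_one, mul_one]
    _ ≤ _ := by
        refine Finset.prod_le_prod (fun e _ => ?_) (fun e _ => ?_)
        · split_ifs
          · exact mul_nonneg (by linarith) hp0'
          · linarith
        · rw [pairWeight]
          split_ifs
          · nlinarith
          · linarith

/-- The opposite comparison, by `p * (1 - p) ≤ 1 - p` on the edges, for the first moment. The
compensating power stays on the left to avoid division. -/
theorem prod_pairWeight_mul_le (hH : HasOrientation H) (hp1 : p < 1) (I : Finset U) :
    (∏ e ∈ pairs I, pairWeight H p e) * (1 - p : ℝ) ^ (2 * I.card) ≤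
      (1 - p : ℝ) ^ (pairs I).card := by
  have hp0' : (0 : ℝ) ≤ p := p.2.1
  have hp1' : (p : ℝ) < 1 := hp1
  calc (∏ e ∈ pairs I, pairWeight H p e) * (1 - p : ℝ) ^ (2 * I.card)
      ≤ (∏ e ∈ pairs I, pairWeight H p e) *
          (1 - p : ℝ) ^ ((pairs I).filter (· ∈ H.edgeSet)).card := by
        refine mul_le_mul_of_nonneg_left ?_ (Finset.prod_nonneg fun e _ => pairWeight_nonneg e)
        exact pow_le_pow_of_le_one (by linarith) (by linarith) (hH.card_edges_le I)
    _ = ∏ e ∈ pairs I, pairWeight H p e * if e ∈ H.edgeSet then (1 - p : ℝ) else 1 := by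
        rw [Finset.prod_mul_distrib]
        congr 1
        rw [Finset.prod_ite, Finset.prod_const, Finset.prod_const_one, mul_one]
    _ ≤ ∏ e ∈ pairs I, (1 - p : ℝ) := by
        refine Finset.prod_le_prod (fun e _ => mul_nonneg (pairWeight_nonneg e) ?_) (fun e _ => ?_)
        · split_ifs <;> linarith
        · rw [pairWeight]
          split_ifs
          · nlinarith
          · linarith
    _ = _ := by rw [Finset.prod_const]

end Weights

/-! ### Copies of a fixed graph in the binomial random graph -/

section Copies
open Classical
variable {U V : Type*} {H : SimpleGraph U} {p : unitInterval}

/-- Independence over disjoint sets of pairs: the two prescriptions agree with a single one on the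
union. -/
theorem binomialRandom_real_prescribed_two [Finite V] {E₁ E₂ : Finset (Sym2 V)}
    (h₁ : ∀ e ∈ E₁, ¬ e.IsDiag)
    (h₂ : ∀ e ∈ E₂, ¬ e.IsDiag) (h : Disjoint E₁ E₂) (s₁ s₂ : Set (Sym2 V)) :
    (SimpleGraph.binomialRandom V p).real {G | (∀ e ∈ E₁, e ∈ G.edgeSet ↔ e ∈ s₁) ∧
      ∀ e ∈ E₂, e ∈ G.edgeSet ↔ e ∈ s₂} =
      (∏ e ∈ E₁, if e ∈ s₁ then (p : ℝ) else 1 - p) *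
        ∏ e ∈ E₂, if e ∈ s₂ then (p : ℝ) else 1 - p := by
  obtain ⟨s, mem₁, mem₂⟩ : ∃ s : Set (Sym2 V), (∀ e ∈ E₁, (e ∈ s ↔ e ∈ s₁)) ∧
      ∀ e ∈ E₂, (e ∈ s ↔ e ∈ s₂) := by
    refine ⟨{e | e ∈ E₁ ∧ e ∈ s₁ ∨ e ∈ E₂ ∧ e ∈ s₂}, fun e he => ?_, fun e he => ?_⟩
    · simp [he, Finset.disjoint_left.1 h he]
    · simp [he, Finset.disjoint_right.1 h he]
  have key := binomialRandom_real_prescribed (p := p) (E₁ ∪ E₂)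
    (fun e he => (Finset.mem_union.1 he).elim (h₁ e) (h₂ e)) s
  rw [Finset.prod_union h] at key
  refine Eq.trans ?_ (key.trans (congrArg₂ (· * ·)
    (Finset.prod_congr rfl fun e he => if_congr (mem₁ e he) rfl rfl)
    (Finset.prod_congr rfl fun e he => if_congr (mem₂ e he) rfl rfl)))
  congr 1
  ext G
  simp only [Finset.forall_mem_union, Set.mem_ofPred_eq (p := fun G : SimpleGraph V => _ ∧ _)]
  exact and_congr (forall₂_congr fun e he => by rw [mem₁ e he])
    (forall₂_congr fun e he => by rw [mem₂ e he])

/-- `f` is an induced copy of `H`. -/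
def copyEvent (H : SimpleGraph U) (f : U → V) : Set (SimpleGraph V) :=
  {G | ∀ u v, G.Adj (f u) (f v) ↔ H.Adj u v}

/-- The probability that a given injection is an induced copy of `H`. -/
noncomputable def copyProb [Fintype U] (H : SimpleGraph U) (p : unitInterval) : ℝ :=
  ∏ e ∈ pairs Finset.univ, pairWeight H p e

theorem mem_copyEvent_iff [Fintype U] {f : U → V} {G : SimpleGraph V} :
    G ∈ copyEvent H f ↔ ∀ e ∈ pairs (Finset.univ : Finset U),
      (Sym2.map f e ∈ G.edgeSet ↔ e ∈ H.edgeSet) := by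
  constructor
  · intro h e _
    induction e using Sym2.ind with
    | _ u v => exact h u v
  · intro h u v
    by_cases huv : u = v
    · subst huv
      simp
    · exact h s(u, v) (mk_mem_pairs.2 ⟨Finset.mem_univ _, Finset.mem_univ _, huv⟩)

theorem forall_mem_image_pairs_iff {f : U → V} (hf : Function.Injective f) {J : Finset (Sym2 U)}
    {G : SimpleGraph V} :
    (∀ e ∈ J.image (Sym2.map f), e ∈ G.edgeSet ↔ e ∈ Sym2.map f '' H.edgeSet) ↔
      ∀ e ∈ J, (Sym2.map f e ∈ G.edgeSet ↔ e ∈ H.edgeSet) := by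
  rw [Finset.forall_mem_image]
  exact forall₂_congr fun e he => by rw [(Sym2.map.injective hf).mem_set_image]

theorem prod_image_pairs {f : U → V} (hf : Function.Injective f) (J : Finset (Sym2 U)) :
    (∏ e ∈ J.image (Sym2.map f), if e ∈ Sym2.map f '' H.edgeSet then (p : ℝ) else 1 - p) =
      ∏ e ∈ J, pairWeight H p e := by
  rw [Finset.prod_image (Sym2.map.injective hf).injOn]
  refine Finset.prod_congr rfl fun e _ => ?_
  rw [pairWeight, if_congr ((Sym2.map.injective hf).mem_set_image) rfl rfl]

theorem not_isDiag_of_mem_image_pairs [Fintype U] {f : U → V} (hf : Function.Injective f)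
    {J : Finset (Sym2 U)} (hJ : J ⊆ pairs Finset.univ) :
    ∀ e ∈ J.image (Sym2.map f), ¬ e.IsDiag := by
  rw [Finset.forall_mem_image]
  intro e he
  have he := hJ he
  induction e using Sym2.ind with
  | _ u v =>
    rw [mk_mem_pairs] at he
    exact fun h => he.2.2 (hf h)

theorem measureReal_copyEvent [Fintype U] [Finite V] {f : U → V} (hf : Function.Injective f) :
    (SimpleGraph.binomialRandom V p).real (copyEvent H f) = copyProb H p := by
  rw [copyProb, ← prod_image_pairs hf, ← binomialRandom_real_prescribed _
    (not_isDiag_of_mem_image_pairs hf subset_rfl)]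
  congr 1
  ext G
  rw [mem_copyEvent_iff]
  exact (forall_mem_image_pairs_iff hf).symm

/-- The pairs from `v` to the copy are disjoint from the pairs inside the copy, so the two
conditions are independent. -/
theorem measureReal_copyEvent_inter_isolated [Fintype U] [Finite V] {f : U → V}
    (hf : Function.Injective f) {v : V}
    (hv : v ∉ Set.range f) :
    (SimpleGraph.binomialRandom V p).real (copyEvent H f ∩ {G | ∀ u, ¬ G.Adj v (f u)}) =
      copyProb H p * (1 - p : ℝ) ^ Fintype.card U := by
  have hinj : Function.Injective fun u => s(v, f u) := fun u u' h => hf (by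
    rcases Sym2.eq_iff.1 h with ⟨-, h⟩ | ⟨h₁, h₂⟩
    · exact h
    · exact h₂.trans h₁)
  have key := binomialRandom_real_prescribed_two (p := p)
    (E₁ := (pairs Finset.univ).image (Sym2.map f)) (E₂ := Finset.univ.image fun u => s(v, f u))
    (not_isDiag_of_mem_image_pairs hf subset_rfl) ?_ ?_ (Sym2.map f '' H.edgeSet) ∅
  · rw [prod_image_pairs hf, Finset.prod_image hinj.injOn] at key
    simp only [Set.mem_empty_iff_false, if_false, Finset.prod_const, Finset.card_univ] at key
    rw [copyProb, ← key]
    congr 1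
    ext G
    rw [Set.mem_inter_iff, mem_copyEvent_iff]
    refine and_congr (forall_mem_image_pairs_iff hf).symm ?_
    rw [Finset.forall_mem_image]
    simp
  · rw [Finset.forall_mem_image]
    exact fun u _ h => hv ⟨u, h.symm⟩
  · rw [Finset.disjoint_left]
    intro e he he'
    rw [Finset.mem_image] at he he'
    obtain ⟨e', -, rfl⟩ := he
    obtain ⟨u, -, hu⟩ := he'
    induction e' using Sym2.ind with
    | _ x y =>
      rw [Sym2.map_mk, Sym2.eq_iff] at hu
      rcases hu with ⟨h, -⟩ | ⟨h, -⟩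
      · exact hv ⟨x, h.symm⟩
      · exact hv ⟨y, h.symm⟩

/-- Only pairs of the second copy with both ends in the first can be prescribed twice. Dropping
these leaves disjoint sets of pairs, hence independent conditions, at the cost of the weight of the
dropped pairs. -/
theorem measureReal_copyEvent_inter_le [Fintype U] [Finite V] {f g : U → V}
    (hf : Function.Injective f) (hg : Function.Injective g) :
    (SimpleGraph.binomialRandom V p).real (copyEvent H f ∩ copyEvent H g) *
      ∏ e ∈ pairs (Finset.univ.filter fun u => g u ∈ Set.range f), pairWeight H p e ≤
      copyProb H p ^ 2 := by
  set I := Finset.univ.filter fun u => g u ∈ Set.range f with hI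
  have hsub : pairs I ⊆ pairs Finset.univ := pairs_mono (Finset.subset_univ _)
  have key := binomialRandom_real_prescribed_two (p := p)
    (E₁ := (pairs Finset.univ).image (Sym2.map f))
    (E₂ := (pairs Finset.univ \ pairs I).image (Sym2.map g))
    (not_isDiag_of_mem_image_pairs hf subset_rfl)
    (not_isDiag_of_mem_image_pairs hg Finset.sdiff_subset) ?_ (Sym2.map f '' H.edgeSet)
    (Sym2.map g '' H.edgeSet)
  · rw [prod_image_pairs hf, prod_image_pairs hg] at key
    rw [sq]
    nth_rw 2 [copyProb]
    rw [← Finset.prod_sdiff hsub, ← mul_assoc]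
    refine mul_le_mul_of_nonneg_right ?_ (Finset.prod_nonneg fun e _ => pairWeight_nonneg e)
    rw [copyProb, ← key]
    refine measureReal_mono ?_
    rintro G ⟨hGf, hGg⟩
    rw [mem_copyEvent_iff] at hGf hGg
    exact ⟨(forall_mem_image_pairs_iff hf).2 hGf, (forall_mem_image_pairs_iff hg).2
      fun e he => hGg e (Finset.sdiff_subset he)⟩
  · rw [Finset.disjoint_left]
    intro e he he'
    rw [Finset.mem_image] at he he'
    obtain ⟨e₁, -, rfl⟩ := he
    obtain ⟨e₂, he₂, h⟩ := he'
    rw [Finset.mem_sdiff] at he₂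
    induction e₁ using Sym2.ind with
    | _ x y =>
      induction e₂ using Sym2.ind with
      | _ u v =>
        rw [Sym2.map_mk, Sym2.map_mk, Sym2.eq_iff] at h
        refine he₂.2 (mk_mem_pairs.2 ⟨?_, ?_, (mk_mem_pairs.1 he₂.1).2.2⟩) <;>
        · rw [hI, Finset.mem_filter]
          refine ⟨Finset.mem_univ _, ?_⟩
          rcases h with ⟨h1, h2⟩ | ⟨h1, h2⟩
          all_goals first
            | exact ⟨x, h1.symm⟩
            | exact ⟨y, h1.symm⟩
            | exact ⟨x, h2.symm⟩
            | exact ⟨y, h2.symm⟩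

theorem copyProb_pos [Fintype U] (hp0 : 0 < p) (hp1 : p < 1) : 0 < copyProb H p :=
  Finset.prod_pos fun e _ => pairWeight_pos hp0 hp1 e

/-- The factor by which a common vertex of two copies increases the probability. -/
noncomputable def overlapFactor (p : unitInterval) (N : ℕ) : ℝ :=
  (√(1 - p : ℝ) ^ N * (p : ℝ) ^ 2)⁻¹

theorem one_le_overlapFactor (hp0 : 0 < p) (hp1 : p < 1) (N : ℕ) : 1 ≤ overlapFactor p N := by
  have hp0' : (0 : ℝ) < p := hp0
  have hp1' : (p : ℝ) < 1 := hp1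
  have h1 : 0 < √(1 - p : ℝ) := Real.sqrt_pos.2 (by linarith)
  have h2 : √(1 - p : ℝ) ≤ 1 := Real.sqrt_le_one.2 (by linarith)
  refine (one_le_inv₀ (by positivity)).2 (mul_le_one₀ (pow_le_one₀ h1.le h2) (by positivity)
    (pow_le_one₀ hp0'.le hp1'.le))

/-- An overlap of `k ≤ N` vertices has `k * (k - 1) / 2` pairs, at most `k * N / 2`, so its cost is
at most one factor `overlapFactor` per common vertex. Being a product over the vertices `u`, the
bound can be summed over all `g` in closed form. -/
theorem measureReal_copyEvent_inter_le_overlap [Fintype U] [Finite V] (hH : HasOrientation H)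
    (hp0 : 0 < p) (hp1 : p < 1) {f g : U → V} (hf : Function.Injective f)
    (hg : Function.Injective g) :
    (SimpleGraph.binomialRandom V p).real (copyEvent H f ∩ copyEvent H g) ≤
      copyProb H p ^ 2 *
        ∏ u, if g u ∈ Set.range f then overlapFactor p (Fintype.card U) else 1 := by
  have hp0' : (0 : ℝ) < p := hp0
  have hp1' : (p : ℝ) < 1 := hp1
  set I := Finset.univ.filter fun u => g u ∈ Set.range f with hI
  set N := Fintype.card U
  have hr : 0 < √(1 - p : ℝ) := Real.sqrt_pos.2 (by linarith)
  have hr1 : √(1 - p : ℝ) ≤ 1 := Real.sqrt_le_one.2 (by linarith)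
  rw [Finset.prod_ite, Finset.prod_const, Finset.prod_const_one, mul_one, ← hI, overlapFactor,
    inv_pow, ← div_eq_mul_inv, le_div_iff₀ (by positivity)]
  refine le_trans ?_ (measureReal_copyEvent_inter_le hf hg)
  refine mul_le_mul_of_nonneg_left ?_ measureReal_nonneg
  refine le_trans ?_ (le_prod_pairWeight hH I)
  rw [mul_pow, ← pow_mul, ← pow_mul]
  refine mul_le_mul_of_nonneg_right ?_ (by positivity)
  have hsq : (1 - p : ℝ) = √(1 - p : ℝ) ^ 2 := (Real.sq_sqrt (by linarith)).symm
  have hle : I.card ≤ N := Finset.card_le_univ I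
  conv_rhs => rw [hsq, ← pow_mul, two_mul_card_pairs, mul_comm]
  refine pow_le_pow_of_le_one hr.le hr1 ?_
  exact Nat.mul_le_mul_right _ (by omega)

end Copies
end EMSOGraph

namespace EMSOGraph

open MeasureTheory

/-! ### Bounds for the probability of a dominating copy -/

section Bounds
open Classical
variable {U V : Type*} {H : SimpleGraph U} {p : unitInterval}

/-- Every vertex outside the range of `f` has a neighbour in the range of `f`. -/
def dominatingEvent (f : U → V) : Set (SimpleGraph V) :=
  {G | ∀ v, v ∉ Set.range f → ∃ u, G.Adj v (f u)}

/-- Union bound over the vertices outside the copy, each of which lacks a neighbour in it with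
probability `(1 - p) ^ N`, independently of the copy. -/
theorem le_measureReal_dominating_copy [Fintype U] [Fintype V] {f : U → V}
    (hf : Function.Injective f) :
    copyProb H p * (1 - Fintype.card V * (1 - p : ℝ) ^ Fintype.card U) ≤
      (SimpleGraph.binomialRandom V p).real (copyEvent H f ∩ dominatingEvent f) := by
  set μ := SimpleGraph.binomialRandom V p
  have hp1' : (p : ℝ) ≤ 1 := p.2.2
  have hP : 0 ≤ copyProb H p := Finset.prod_nonneg fun e _ => pairWeight_nonneg e
  have hsub : copyEvent H f ⊆ (copyEvent H f ∩ dominatingEvent f) ∪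
      ⋃ v ∈ Finset.univ.filter (· ∉ Set.range f), copyEvent H f ∩ {G | ∀ u, ¬ G.Adj v (f u)} := by
    intro G hG
    by_cases hd : G ∈ dominatingEvent f
    · exact Or.inl ⟨hG, hd⟩
    · right
      simp only [dominatingEvent, Set.mem_ofPred_eq, not_forall, not_exists] at hd
      obtain ⟨v, hv, hd⟩ := hd
      exact Set.mem_biUnion (by simpa using hv) ⟨hG, hd⟩
  have h1 := (measureReal_mono (μ := μ) hsub).trans (measureReal_union_le _ _)
  have h2 := measureReal_biUnion_finset_le (μ := μ) (Finset.univ.filter (· ∉ Set.range f))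
    fun v => copyEvent H f ∩ {G | ∀ u, ¬ G.Adj v (f u)}
  rw [Finset.sum_congr rfl fun v hv => measureReal_copyEvent_inter_isolated hf
    (Finset.mem_filter.1 hv).2, Finset.sum_const, nsmul_eq_mul] at h2
  rw [measureReal_copyEvent hf] at h1
  have h3 : ((Finset.univ.filter (· ∉ Set.range f)).card : ℝ) ≤ Fintype.card V :=
    mod_cast Finset.card_le_univ _
  have h4 : 0 ≤ copyProb H p * (1 - p : ℝ) ^ Fintype.card U :=
    mul_nonneg hP (pow_nonneg (by linarith) _)
  have h5 := mul_le_mul_of_nonneg_right h3 h4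
  linarith

/-- The sum over all functions factorises over `u`; in each factor exactly the points in the range
of `f` contribute `y` instead of one. -/
theorem sum_prod_ite_range [Fintype U] [Fintype V] {f : U → V} (hf : Function.Injective f) (y : ℝ) :
    ∑ g : U → V, ∏ u, (if g u ∈ Set.range f then y else 1) =
      (Fintype.card V + Fintype.card U * (y - 1)) ^ Fintype.card U := by
  have h := Finset.prod_univ_sum (fun _ : U => (Finset.univ : Finset V))
    fun (_ : U) v => if v ∈ Set.range f then y else (1 : ℝ)
  rw [Fintype.piFinset_univ] at h
  rw [← h, Finset.prod_const, Finset.card_univ]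
  congr 1
  have hcard : (Finset.univ.filter (· ∈ Set.range f)).card = Fintype.card U := by
    rw [← Finset.card_univ, ← Finset.card_image_of_injective _ hf]
    congr 1
    ext v
    simp
  have hsum : ∀ v, (if v ∈ Set.range f then y else (1 : ℝ)) =
      1 + if v ∈ Set.range f then y - 1 else 0 := by
    intro v
    split_ifs <;> ring
  simp only [hsum]
  rw [Finset.sum_add_distrib, ← Finset.sum_filter, Finset.sum_const, Finset.sum_const, hcard]
  simp

theorem card_filter_injective [Fintype U] [Fintype V] :
    (Finset.univ.filter fun f : U → V => Function.Injective f).card =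
      (Fintype.card V).descFactorial (Fintype.card U) := by
  rw [← Fintype.card_embedding_eq, ← Fintype.card_subtype]
  exact Fintype.card_congr (Equiv.subtypeInjectiveEquivEmbedding U V)

theorem hasInducedDominatingCopy_of_mem {f : U → V} (hf : Function.Injective f) {G : SimpleGraph V}
    (hG : G ∈ copyEvent H f ∩ dominatingEvent f) : HasInducedDominatingCopy H G :=
  ⟨⟨⟨f, hf⟩, fun {u v} => hG.1 u v⟩, hG.2⟩

/-- Chung–Erdős for the events that an injection is a dominating copy. For the first moment, `δ`
bounds the loss due to domination. For the second, domination is dropped and the inner sum is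
extended from injections to all functions. The copy probability cancels. -/
theorem sq_mul_descFactorial_le [Fintype U] [Fintype V] (hH : HasOrientation H) (hp0 : 0 < p)
    (hp1 : p < 1) (hdom : Fintype.card V * (1 - p : ℝ) ^ Fintype.card U ≤ 1)
    (hcard : Fintype.card U ≤ Fintype.card V) :
    (1 - Fintype.card V * (1 - p : ℝ) ^ Fintype.card U) ^ 2 *
        (Fintype.card V).descFactorial (Fintype.card U) ≤
      (SimpleGraph.binomialRandom V p).real {G | HasInducedDominatingCopy H G} *
        (Fintype.card V + Fintype.card U * overlapFactor p (Fintype.card U)) ^ Fintype.card U := by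
  set μ := SimpleGraph.binomialRandom V p
  set y := overlapFactor p (Fintype.card U)
  set δ := (1 - Fintype.card V * (1 - p : ℝ) ^ Fintype.card U) with hδ
  set F := Finset.univ.filter fun f : U → V => Function.Injective f with hF
  set P := copyProb H p
  have hP : 0 < P := copyProb_pos hp0 hp1
  have hy : 1 ≤ y := one_le_overlapFactor hp0 hp1 _
  have hδ0 : 0 ≤ δ := by linarith
  have hFinj : ∀ f ∈ F, Function.Injective f := fun f hf => (Finset.mem_filter.1 hf).2
  set D : ℝ := ((Fintype.card V).descFactorial (Fintype.card U) : ℝ) with hD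
  set K : ℝ := (Fintype.card V + Fintype.card U * y) ^ Fintype.card U with hK
  have hFcard : (F.card : ℝ) = D := by rw [hF, card_filter_injective]
  have hDpos : 0 < D := by
    rw [hD]
    exact_mod_cast Nat.pow_sub_le_descFactorial _ _ |>.trans_lt' (pow_pos (by omega) _)
  have key := sq_sum_measureReal_le (μ := μ) F fun f => copyEvent H f ∩ dominatingEvent f
  have h1 : D * (P * δ) ≤ ∑ f ∈ F, μ.real (copyEvent H f ∩ dominatingEvent f) := by
    rw [← hFcard, ← nsmul_eq_mul]
    exact Finset.card_nsmul_le_sum _ _ _ fun f hf => le_measureReal_dominating_copy (hFinj f hf)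
  have h2 : ∑ f ∈ F, ∑ g ∈ F, μ.real ((copyEvent H f ∩ dominatingEvent f) ∩
      (copyEvent H g ∩ dominatingEvent g)) ≤ D * (P ^ 2 * K) := by
    rw [← hFcard, ← nsmul_eq_mul]
    refine Finset.sum_le_card_nsmul _ _ _ fun f hf => ?_
    calc ∑ g ∈ F, μ.real ((copyEvent H f ∩ dominatingEvent f) ∩
          (copyEvent H g ∩ dominatingEvent g))
        ≤ ∑ g ∈ F, P ^ 2 * ∏ u, (if g u ∈ Set.range f then y else 1) := by
          refine Finset.sum_le_sum fun g hg => ?_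
          refine le_trans (measureReal_mono ?_)
            (measureReal_copyEvent_inter_le_overlap hH hp0 hp1 (hFinj f hf) (hFinj g hg))
          exact fun G hG => ⟨hG.1.1, hG.2.1⟩
      _ ≤ ∑ g : U → V, P ^ 2 * ∏ u, (if g u ∈ Set.range f then y else 1) := by
          refine Finset.sum_le_sum_of_subset_of_nonneg (Finset.subset_univ _) fun g _ _ => ?_
          refine mul_nonneg (by positivity) (Finset.prod_nonneg fun u _ => ?_)
          split_ifs <;> linarith
      _ = P ^ 2 * (Fintype.card V + Fintype.card U * (y - 1)) ^ Fintype.card U := by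
          rw [← Finset.mul_sum, sum_prod_ite_range (hFinj f hf)]
      _ ≤ P ^ 2 * K := by
          refine mul_le_mul_of_nonneg_left (pow_le_pow_left₀ ?_ ?_ _) (by positivity)
          · have : 0 ≤ (Fintype.card U : ℝ) * (y - 1) :=
              mul_nonneg (Nat.cast_nonneg _) (by linarith)
            positivity
          · have : 0 ≤ (Fintype.card U : ℝ) := Nat.cast_nonneg _
            linarith
  have h3 : μ.real (⋃ f ∈ F, copyEvent H f ∩ dominatingEvent f) ≤
      μ.real {G | HasInducedDominatingCopy H G} := by
    refine measureReal_mono (Set.iUnion₂_subset fun f hf G hG => ?_)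
    exact hasInducedDominatingCopy_of_mem (hFinj f hf) hG
  set M := μ.real {G | HasInducedDominatingCopy H G}
  have h4 : (D * (P * δ)) ^ 2 ≤ M * (D * (P ^ 2 * K)) := by
    refine (pow_le_pow_left₀ (by positivity) h1 2).trans (key.trans ?_)
    refine mul_le_mul h3 h2 ?_ measureReal_nonneg
    exact Finset.sum_nonneg fun f _ => Finset.sum_nonneg fun g _ => measureReal_nonneg
  have h5 : (D * P ^ 2) * (δ ^ 2 * D) ≤ (D * P ^ 2) * (M * K) := by linarith
  exact le_of_mul_le_mul_left h5 (by positivity)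

/-- A lower bound for the probability of a dominating copy, by the second moment method. -/
theorem le_measureReal_hasInducedDominatingCopy [Fintype U] [Fintype V] (hH : HasOrientation H)
    (hp0 : 0 < p) (hp1 : p < 1) (hV : 0 < Fintype.card V) :
    1 - 2 * (Fintype.card V * (1 - p : ℝ) ^ Fintype.card U) -
        Fintype.card U ^ 2 * (1 + overlapFactor p (Fintype.card U)) / Fintype.card V ≤
      (SimpleGraph.binomialRandom V p).real {G | HasInducedDominatingCopy H G} := by
  have key := sq_mul_descFactorial_le (V := V) hH hp0 hp1
  have hq : (0 : ℝ) ≤ 1 - p := sub_nonneg.2 p.2.2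
  have hy := one_le_overlapFactor hp0 hp1 (Fintype.card U)
  have hdesc := Nat.pow_sub_le_descFactorial (Fintype.card V) (Fintype.card U)
  set M := (SimpleGraph.binomialRandom V p).real {G | HasInducedDominatingCopy H G}
  have hM : 0 ≤ M := measureReal_nonneg
  set y := overlapFactor p (Fintype.card U)
  generalize Fintype.card U = N at *
  generalize Fintype.card V = n at *
  have hn : (0 : ℝ) < n := Nat.cast_pos.2 hV
  have hN : (0 : ℝ) ≤ N := Nat.cast_nonneg N
  set α := n * (1 - p : ℝ) ^ N with hα
  have hα0 : 0 ≤ α := by positivity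
  set β := (N : ℝ) ^ 2 * (1 + y) / n with hβ
  have hβ0 : 0 ≤ β := by positivity
  -- Outside this case the claimed lower bound is at most zero.
  by_cases hsmall : α ≤ 1 ∧ β ≤ 1
  swap
  · have : 1 - 2 * α - β ≤ 0 := by
      by_contra hcon
      exact hsmall ⟨by linarith, by linarith⟩
    linarith
  obtain ⟨hα1, hβ1⟩ := hsmall
  have hNn' : (N : ℝ) * (1 + y) ≤ n := by
    rw [hβ, div_le_one hn] at hβ1
    rcases Nat.eq_zero_or_pos N with h0 | h0
    · rw [h0]
      simp
    · have h1 : (1 : ℝ) ≤ N := by exact_mod_cast h0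
      have h2 : 0 ≤ (N : ℝ) * (1 + y) := by positivity
      nlinarith
  have hNn : (N : ℝ) ≤ n := by nlinarith
  have hNn_nat : N ≤ n := by exact_mod_cast hNn
  have h1 := key hα1 hNn_nat
  have hdesc' : ((n : ℝ) - N) ^ N ≤ n.descFactorial N := by
    have h2 : ((n + 1 - N : ℕ) : ℝ) ^ N ≤ n.descFactorial N := by exact_mod_cast hdesc
    refine le_trans (pow_le_pow_left₀ (by linarith) ?_ _) h2
    rw [Nat.cast_sub (by omega)]
    push_cast
    linarith
  have hpos : 0 < (n : ℝ) + N * y := by positivity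
  have h3 : (1 - β) * ((n : ℝ) + N * y) ^ N ≤ ((n : ℝ) - N) ^ N := by
    -- Bernoulli's inequality turns the `N`-th power into the linear loss `β`; `h5` compares the
    -- bases.
    have h4 : 1 - β ≤ (1 + -(N * (1 + y) / n)) ^ N := by
      have := one_add_mul_le_pow (a := -((N : ℝ) * (1 + y) / n)) (by
        have : (N : ℝ) * (1 + y) / n ≤ 1 := (div_le_one hn).2 hNn'
        linarith) N
      refine le_trans (le_of_eq ?_) this
      rw [hβ]
      ring
    have h5 : (1 + -(N * (1 + y) / n)) * ((n : ℝ) + N * y) ≤ n - N := by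
      have : (1 + -(N * (1 + y) / n)) * ((n : ℝ) + N * y) =
          n - N - N * (1 + y) * (N * y) / n := by
        field_simp
        ring
      rw [this]
      have : 0 ≤ N * (1 + y) * (N * y) / n := by positivity
      linarith
    have h6 : 0 ≤ 1 + -(N * (1 + y) / n) := by
      have : (N : ℝ) * (1 + y) / n ≤ 1 := (div_le_one hn).2 hNn'
      linarith
    calc (1 - β) * ((n : ℝ) + N * y) ^ N
        ≤ (1 + -(N * (1 + y) / n)) ^ N * ((n : ℝ) + N * y) ^ N := by gcongr
      _ = ((1 + -(N * (1 + y) / n)) * ((n : ℝ) + N * y)) ^ N := (mul_pow _ _ _).symm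
      _ ≤ _ := pow_le_pow_left₀ (by positivity) h5 _
  have h7 : (1 - α) ^ 2 * (1 - β) * ((n : ℝ) + N * y) ^ N ≤ M * ((n : ℝ) + N * y) ^ N := by
    refine le_trans ?_ h1
    rw [mul_assoc]
    exact mul_le_mul_of_nonneg_left (h3.trans hdesc') (sq_nonneg _)
  have h8 := le_of_mul_le_mul_right h7 (pow_pos hpos N)
  refine le_trans ?_ h8
  nlinarith [mul_nonneg (sq_nonneg α) (sub_nonneg.2 hβ1), mul_nonneg hα0 hβ0]

/-- The first moment bound for the probability of an induced copy. -/
theorem measureReal_exists_copy_mul_le [Fintype U] [Fintype V] (hH : HasOrientation H)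
    (hp1 : p < 1) :
    (SimpleGraph.binomialRandom V p).real {G | Nonempty (H ↪g G)} *
        (1 - p : ℝ) ^ (2 * Fintype.card U) ≤
      (Fintype.card V : ℝ) ^ Fintype.card U *
        (1 - p : ℝ) ^ (pairs (Finset.univ : Finset U)).card := by
  set μ := SimpleGraph.binomialRandom V p
  have hq : (0 : ℝ) ≤ 1 - p := sub_nonneg.2 p.2.2
  have hP : 0 ≤ copyProb H p := Finset.prod_nonneg fun e _ => pairWeight_nonneg e
  have h1 : μ.real {G | Nonempty (H ↪g G)} ≤ (Fintype.card V : ℝ) ^ Fintype.card U *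
      copyProb H p := by
    have hsub : {G : SimpleGraph V | Nonempty (H ↪g G)} ⊆
        ⋃ f ∈ Finset.univ.filter fun f : U → V => Function.Injective f, copyEvent H f := by
      rintro G ⟨f⟩
      exact Set.mem_biUnion (x := (f : U → V)) (by simpa using f.injective)
        fun u v => f.map_adj_iff
    refine (measureReal_mono hsub (measure_ne_top _ _)).trans
      ((measureReal_biUnion_finset_le _ _).trans ?_)
    rw [Finset.sum_congr rfl fun f hf => measureReal_copyEvent (Finset.mem_filter.1 hf).2,
      Finset.sum_const, nsmul_eq_mul]
    refine mul_le_mul_of_nonneg_right ?_ hP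
    have := Finset.card_le_univ (Finset.univ.filter fun f : U → V => Function.Injective f)
    rw [Fintype.card_fun] at this
    exact_mod_cast this
  have h2 := prod_pairWeight_mul_le hH hp1 (Finset.univ : Finset U)
  rw [Finset.card_univ] at h2
  calc _ ≤ (Fintype.card V : ℝ) ^ Fintype.card U * copyProb H p *
        (1 - p : ℝ) ^ (2 * Fintype.card U) := by gcongr
    _ = (Fintype.card V : ℝ) ^ Fintype.card U * (copyProb H p *
        (1 - p : ℝ) ^ (2 * Fintype.card U)) := mul_assoc _ _ _
    _ ≤ _ := mul_le_mul_of_nonneg_left h2 (by positivity)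

/-- The pairs between distinct outside vertices and `T` are disjoint, so the failures to have a
neighbour in `T` are independent, each of probability `(1 - p) ^ |T|`. -/
theorem measureReal_dominating [Fintype V] (T : Finset V) :
    (SimpleGraph.binomialRandom V p).real {G | ∀ v, v ∉ T → ∃ u ∈ T, G.Adj v u} =
      (1 - (1 - p : ℝ) ^ T.card) ^ (Fintype.card V - T.card) := by
  have key := measureReal_forall_not_mem (μ := SimpleGraph.binomialRandom V p)
    (B := fun v => {G | ∀ u ∈ T, ¬ G.Adj v u}) (x := (1 - p : ℝ) ^ T.card) (r := Tᶜ)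
    (s := Tᶜ) ?_ subset_rfl
  · rw [Finset.card_compl] at key
    rw [← key]
    congr 1
    ext G
    simp
  · intro t ht
    have hinj : Set.InjOn (fun x : V × V => s(x.1, x.2)) (t ×ˢ T : Finset (V × V)) := by
      rintro ⟨v, u⟩ h ⟨v', u'⟩ h' heq
      simp only [Finset.coe_product, Set.mem_prod, Finset.mem_coe] at h h'
      rcases Sym2.eq_iff.1 heq with ⟨h1, h2⟩ | ⟨h1, h2⟩
      · exact Prod.ext h1 h2
      · have h1 : v = u' := h1
        exact absurd (h1 ▸ h'.2) (Finset.mem_compl.1 (ht h.1))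
    have h := binomialRandom_real_prescribed (p := p)
      ((t ×ˢ T).image fun x : V × V => s(x.1, x.2)) ?_ ∅
    · rw [Finset.prod_image hinj] at h
      simp only [Set.mem_empty_iff_false, if_false, Finset.prod_const, Finset.card_product] at h
      rw [← pow_mul, mul_comm, ← h]
      congr 1
      ext G
      simp only [Finset.forall_mem_image, Set.mem_ofPred_eq, Finset.mem_product, Prod.forall,
        SimpleGraph.mem_edgeSet, iff_false, and_imp]
      exact ⟨fun h v u hv hu => h v hv u hu, fun h v hv u hu => h v u hv hu⟩
    · rw [Finset.forall_mem_image]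
      rintro ⟨v, u⟩ h hd
      rw [Finset.mem_product] at h
      obtain rfl : v = u := hd
      exact Finset.mem_compl.1 (ht h.1) h.2

/-- The first moment bound for the probability of a small dominating set. -/
theorem measureReal_exists_dominating_le [Fintype V] {M : ℕ} (hM : M ≤ Fintype.card V) :
    (SimpleGraph.binomialRandom V p).real {G | ∃ T : Finset V, T.Nonempty ∧ T.card ≤ M ∧
        ∀ v, v ∉ T → ∃ u ∈ T, G.Adj v u} ≤
      (Fintype.card V : ℝ) ^ M * (1 - (1 - p : ℝ) ^ M) ^ (Fintype.card V - M) := by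
  have hq : (0 : ℝ) ≤ 1 - p := sub_nonneg.2 p.2.2
  have hq1 : (1 - p : ℝ) ≤ 1 := by linarith [p.2.1]
  have hsub : {G : SimpleGraph V | ∃ T : Finset V, T.Nonempty ∧ T.card ≤ M ∧
      ∀ v, v ∉ T → ∃ u ∈ T, G.Adj v u} ⊆ ⋃ h ∈ (Finset.univ : Finset (Fin M → V)),
        {G | ∀ v, v ∉ Finset.univ.image h → ∃ u ∈ Finset.univ.image h, G.Adj v u} := by
    rintro G ⟨T, hT, hcard, hdom⟩
    -- A nonempty set of at most `M` elements is the image of a function on `Fin M`: enumerate it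
    -- and repeat one element. All sizes up to `M` are thus covered by one union bound with `n ^ M`
    -- terms.
    obtain ⟨h, hh⟩ : ∃ h : Fin M → V, Finset.univ.image h = T := by
      have : Nonempty T := hT.to_subtype
      let e := T.equivFin
      refine ⟨fun i => if hi : (i : ℕ) < T.card then (e.symm ⟨i, hi⟩ : V) else hT.choose, ?_⟩
      ext v
      simp only [Finset.mem_image, Finset.mem_univ, true_and]
      constructor
      · rintro ⟨i, rfl⟩
        split_ifs with hi
        · exact (e.symm ⟨i, hi⟩).2
        · exact hT.choose_spec
      · intro hv
        refine ⟨⟨e ⟨v, hv⟩, (e ⟨v, hv⟩).2.trans_le hcard⟩, ?_⟩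
        simp
    refine Set.mem_biUnion (Finset.mem_univ h) ?_
    rw [← hh] at hdom
    exact hdom
  refine (measureReal_mono hsub (measure_ne_top _ _)).trans
      ((measureReal_biUnion_finset_le _ _).trans ?_)
  have hcardfun : (Finset.univ : Finset (Fin M → V)).card = Fintype.card V ^ M := by
    simp
  refine (Finset.sum_le_card_nsmul _ _ ((1 - (1 - p : ℝ) ^ M) ^ (Fintype.card V - M))
    fun h _ => ?_).trans (le_of_eq ?_)
  · rw [measureReal_dominating]
    have hle : (Finset.univ.image h).card ≤ M := by
      simpa using Finset.card_image_le (s := Finset.univ) (f := h)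
    have h1 : (1 - p : ℝ) ^ M ≤ (1 - p : ℝ) ^ (Finset.univ.image h).card :=
      pow_le_pow_of_le_one hq hq1 hle
    have h2 : (1 - p : ℝ) ^ (Finset.univ.image h).card ≤ 1 := pow_le_one₀ hq hq1
    have h3 : 0 ≤ (1 - p : ℝ) ^ M := pow_nonneg hq _
    calc _ ≤ (1 - (1 - p : ℝ) ^ M) ^ (Fintype.card V - (Finset.univ.image h).card) :=
          pow_le_pow_left₀ (by linarith) (by linarith) _
      _ ≤ _ := pow_le_pow_of_le_one (by linarith) (by linarith) (by omega)
  · rw [nsmul_eq_mul, hcardfun]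
    push_cast
    rfl

end Bounds
end EMSOGraph

namespace EMSOGraph

open MeasureTheory Filter

/-! ### The probability of a dominating copy of some `graphW a` along two sequences -/

section Asymptotics

/-- The probability that `G(n, p)` has a dominating induced copy of some `W_a`. -/
noncomputable def dominatingCopyProb (p : unitInterval) (n : ℕ) : ℝ :=
  (SimpleGraph.binomialRandom (Fin n) p).real
    {G | ∃ a : ℕ+, HasInducedDominatingCopy (graphW a) G}

variable {p : unitInterval} {s : ℝ}

theorem hasOrientation_graphW (a : ℕ+) : HasOrientation (graphW a) :=
  graphW_exists_orientation a

/-- Together with `one_le_ceil_inv_pow_mul`, this shows that rounding `s⁻¹ ^ k` up costs at most a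
factor two. -/
theorem ceil_inv_pow_mul_le (hs0 : 0 < s) (hs1 : s < 1) (k : ℕ) :
    (⌈s⁻¹ ^ k⌉₊ : ℝ) * s ^ k ≤ 2 := by
  have h1 : (⌈s⁻¹ ^ k⌉₊ : ℝ) < s⁻¹ ^ k + 1 := Nat.ceil_lt_add_one (by positivity)
  have h2 : s ^ k ≤ 1 := pow_le_one₀ hs0.le hs1.le
  have h3 : s⁻¹ ^ k * s ^ k = 1 := by rw [← mul_pow, inv_mul_cancel₀ hs0.ne', one_pow]
  have h4 : 0 < s ^ k := by positivity
  nlinarith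

theorem one_le_ceil_inv_pow_mul (hs0 : 0 < s) (k : ℕ) : 1 ≤ (⌈s⁻¹ ^ k⌉₊ : ℝ) * s ^ k := by
  have h1 : s⁻¹ ^ k ≤ (⌈s⁻¹ ^ k⌉₊ : ℝ) := Nat.le_ceil _
  have h3 : s⁻¹ ^ k * s ^ k = 1 := by rw [← mul_pow, inv_mul_cancel₀ hs0.ne', one_pow]
  rw [← h3]
  gcongr

/-- Here `n` is about `s ^ (-4N)`: domination costs `n * s ^ (6N)`, of order `s ^ (2N)`, and
overlaps cost `N ^ 2 * s ^ (-3N) / n`, of order `N ^ 2 * s ^ N`. -/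
theorem le_dominatingCopyProb (hp0 : 0 < p) (hp1 : p < 1) (hs0 : 0 < s) (hs1 : s < 1)
    (hs : s ^ 6 = 1 - p) (a : ℕ+) :
    1 - 4 * s ^ orderW a - (1 + ((p : ℝ) ^ 2)⁻¹) * ((orderW a : ℝ) ^ 2 * s ^ orderW a) ≤
      dominatingCopyProb p ⌈s⁻¹ ^ (4 * orderW a)⌉₊ := by
  have := Fintype.ofFinite (Fin (a : ℕ) ⊕ {w : List (Fin 4) // w.length < (a : ℕ)})
  have hN : Fintype.card (Fin (a : ℕ) ⊕ {w : List (Fin 4) // w.length < (a : ℕ)}) = orderW a := by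
    rw [← Nat.card_eq_fintype_card, card_vertices_graphW]
  have hp0' : (0 : ℝ) < p := hp0
  have hn1 := ceil_inv_pow_mul_le hs0 hs1 (4 * orderW a)
  have hn2 := one_le_ceil_inv_pow_mul hs0 (4 * orderW a)
  have hpos : 0 < ⌈s⁻¹ ^ (4 * orderW a)⌉₊ := Nat.ceil_pos.2 (by positivity)
  have key := le_measureReal_hasInducedDominatingCopy (V := Fin ⌈s⁻¹ ^ (4 * orderW a)⌉₊)
    (hasOrientation_graphW a) hp0 hp1 (by simpa using hpos)
  rw [hN, Fintype.card_fin] at key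
  have hsqrt : √(1 - p : ℝ) = s ^ 3 := by
    rw [← hs, show s ^ 6 = (s ^ 3) ^ 2 by ring, Real.sqrt_sq (by positivity)]
  rw [overlapFactor, hsqrt, ← hs] at key
  refine le_trans ?_ (key.trans (measureReal_mono fun G hG => ⟨a, hG⟩))
  generalize orderW a = N at *
  have hn : (0 : ℝ) < ⌈s⁻¹ ^ (4 * N)⌉₊ := by exact_mod_cast hpos
  generalize (⌈s⁻¹ ^ (4 * N)⌉₊ : ℝ) = n at *
  have hsN : s ^ N ≤ 1 := pow_le_one₀ hs0.le hs1.le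
  have hsN0 : 0 < s ^ N := by positivity
  have e1 : n * (s ^ 6) ^ N ≤ 2 * s ^ N := by
    calc n * (s ^ 6) ^ N = (n * s ^ (4 * N)) * (s ^ N * s ^ N) := by ring
      _ ≤ 2 * (s ^ N * 1) := by gcongr
      _ = _ := by ring
  have e2 : (N : ℝ) ^ 2 * (1 + ((s ^ 3) ^ N * (p : ℝ) ^ 2)⁻¹) / n ≤
      (1 + ((p : ℝ) ^ 2)⁻¹) * ((N : ℝ) ^ 2 * s ^ N) := by
    rw [div_le_iff₀ hn]
    have h1 : (1 + ((s ^ 3) ^ N * (p : ℝ) ^ 2)⁻¹) ≤ (1 + ((p : ℝ) ^ 2)⁻¹) * (s ^ N * n) := by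
      have h2 : ((s ^ 3) ^ N)⁻¹ ≤ s ^ N * n := by
        rw [inv_le_iff_one_le_mul₀ (by positivity)]
        calc 1 ≤ n * s ^ (4 * N) := hn2
          _ = _ := by ring
      have h3 : 1 ≤ ((s ^ 3) ^ N)⁻¹ :=
        (one_le_inv₀ (by positivity)).2 (pow_le_one₀ (by positivity)
          (pow_le_one₀ hs0.le hs1.le))
      have h4 : 0 < ((p : ℝ) ^ 2)⁻¹ := by positivity
      rw [mul_inv]
      nlinarith
    calc (N : ℝ) ^ 2 * (1 + ((s ^ 3) ^ N * (p : ℝ) ^ 2)⁻¹)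
        ≤ (N : ℝ) ^ 2 * ((1 + ((p : ℝ) ^ 2)⁻¹) * (s ^ N * n)) := by gcongr
      _ = _ := by ring
  linarith

/-- With `M` and `N` the orders of `W_a` and `W_(a+1)`, `N ≥ 3M` makes the base `n * s ^ (3 * (N -
1))` of the first moment bound at most a constant times `s ^ (9M - 8M)`. -/
theorem measureReal_exists_graphW_le (hp1 : p < 1) (hs0 : 0 < s) (hs1 : s < 1)
    (hs : s ^ 6 = 1 - p) (a : ℕ+) :
    (SimpleGraph.binomialRandom (Fin ⌈s⁻¹ ^ (8 * orderW a)⌉₊) p).real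
      {G | Nonempty (graphW (a + 1) ↪g G)} ≤ 2 * s⁻¹ ^ 15 * s ^ orderW a := by
  have := Fintype.ofFinite
    (Fin ((a + 1 : ℕ+) : ℕ) ⊕ {w : List (Fin 4) // w.length < ((a + 1 : ℕ+) : ℕ)})
  have hN : Fintype.card
      (Fin ((a + 1 : ℕ+) : ℕ) ⊕ {w : List (Fin 4) // w.length < ((a + 1 : ℕ+) : ℕ)}) =
      orderW (a + 1) := by
    rw [← Nat.card_eq_fintype_card, card_vertices_graphW, PNat.add_coe, PNat.one_coe]
  have h3 := three_mul_orderW_le a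
  have hNpos : 1 ≤ orderW (a + 1) := le_trans (by omega) (le_orderW (a + 1))
  have hn1 := ceil_inv_pow_mul_le hs0 hs1 (8 * orderW a)
  have key := measureReal_exists_copy_mul_le (V := Fin ⌈s⁻¹ ^ (8 * orderW a)⌉₊)
    (hasOrientation_graphW (a + 1)) hp1
  have hcard := two_mul_card_pairs (Finset.univ :
    Finset (Fin ((a + 1 : ℕ+) : ℕ) ⊕ {w : List (Fin 4) // w.length < ((a + 1 : ℕ+) : ℕ)}))
  rw [Finset.card_univ, hN] at hcard
  rw [hN, Fintype.card_fin, ← hs, ← pow_mul, ← pow_mul,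
    show 6 * (pairs (Finset.univ : Finset (Fin ((a + 1 : ℕ+) : ℕ) ⊕
      {w : List (Fin 4) // w.length < ((a + 1 : ℕ+) : ℕ)}))).card =
      3 * (orderW (a + 1) - 1) * orderW (a + 1) by
      rw [mul_assoc, mul_comm _ (orderW _), ← hcard]; ring,
    pow_mul s (3 * (orderW (a + 1) - 1)), ← mul_pow, show 6 * (2 * orderW (a + 1)) =
      12 * orderW (a + 1) by ring, pow_mul s 12] at key
  have hE1 := measureReal_le_one (μ := SimpleGraph.binomialRandom (Fin ⌈s⁻¹ ^ (8 * orderW a)⌉₊) p)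
    (s := {G | Nonempty (graphW (a + 1) ↪g G)})
  generalize (SimpleGraph.binomialRandom (Fin ⌈s⁻¹ ^ (8 * orderW a)⌉₊) p).real
    {G | Nonempty (graphW (a + 1) ↪g G)} = E at *
  have hn0 : (0 : ℝ) ≤ ⌈s⁻¹ ^ (8 * orderW a)⌉₊ := Nat.cast_nonneg _
  generalize (⌈s⁻¹ ^ (8 * orderW a)⌉₊ : ℝ) = n at *
  generalize orderW a = M at *
  generalize orderW (a + 1) = N at *
  -- The exponent 15 is 12 from the edge correction `s ^ (12N)` plus 3 from `N - 1` in place of `N`;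
  -- the factor 2 comes from rounding `n`. If `B > 1` the claim is trivial.
  set B := 2 * s⁻¹ ^ 15 * s ^ M with hB
  have hB0 : 0 < B := by positivity
  by_cases hB1 : B ≤ 1
  swap
  · linarith
  have h4 : n * s ^ (3 * (N - 1)) ≤ B * s ^ 12 := by
    have h5 : B * s ^ 12 * s ^ 3 = 2 * s ^ M := by
      rw [hB]
      field_simp
    have h6 : n * s ^ (3 * (N - 1)) * s ^ 3 ≤ B * s ^ 12 * s ^ 3 := by
      rw [h5, mul_assoc, ← pow_add]
      calc n * s ^ (3 * (N - 1) + 3) ≤ n * s ^ (8 * M + M) := by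
            refine mul_le_mul_of_nonneg_left ?_ hn0
            exact pow_le_pow_of_le_one hs0.le hs1.le (by omega)
        _ = n * s ^ (8 * M) * s ^ M := by rw [pow_add, mul_assoc]
        _ ≤ _ := by gcongr
    exact le_of_mul_le_mul_right h6 (by positivity)
  have h7 : E * (s ^ 12) ^ N ≤ B ^ N * (s ^ 12) ^ N := by
    rw [← mul_pow]
    exact key.trans (pow_le_pow_left₀ (by positivity) h4 N)
  have h8 := le_of_mul_le_mul_right h7 (by positivity)
  exact h8.trans (pow_le_of_le_one hB0.le hB1 (by omega))

/-- The entropy `M * log n` of choosing the set is quadratic in `M`, while the exponent `n * s ^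
(6M)` of the failure probability is at least `s ^ (-2M)`. -/
theorem pow_mul_one_sub_pow_le (hs0 : 0 < s) (hs1 : s < 1) {M : ℕ}
    (hM : M ≤ ⌈s⁻¹ ^ (8 * M)⌉₊) :
    (⌈s⁻¹ ^ (8 * M)⌉₊ : ℝ) ^ M * (1 - (s ^ 6) ^ M) ^ (⌈s⁻¹ ^ (8 * M)⌉₊ - M) ≤
      Real.exp ((3 + 8 * Real.log s⁻¹) * (M : ℝ) ^ 2 - (s⁻¹ ^ 2) ^ M) := by
  have hn1 := ceil_inv_pow_mul_le hs0 hs1 (8 * M)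
  have hn2 := one_le_ceil_inv_pow_mul hs0 (8 * M)
  generalize ⌈s⁻¹ ^ (8 * M)⌉₊ = n at *
  have hq1 : (s ^ 6) ^ M ≤ 1 := pow_le_one₀ (by positivity) (pow_le_one₀ hs0.le hs1.le)
  have hlog : 0 ≤ Real.log s⁻¹ := Real.log_nonneg ((one_le_inv₀ hs0).2 hs1.le)
  have hM0 : (0 : ℝ) ≤ M := Nat.cast_nonneg M
  have hMsq : (M : ℝ) ≤ (M : ℝ) ^ 2 := by exact_mod_cast Nat.le_self_pow (by norm_num) M
  -- The summand 1 absorbs the rounding factor two, because `2 ≤ exp 1`.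
  have h1 : (n : ℝ) ≤ Real.exp (1 + 8 * M * Real.log s⁻¹) := by
    have h2 : Real.exp (8 * M * Real.log s⁻¹) = s⁻¹ ^ (8 * M) := by
      rw [← Real.exp_log (show 0 < s⁻¹ ^ (8 * M) by positivity), Real.log_pow]
      push_cast
      rfl
    rw [Real.exp_add, h2]
    have h3 : (n : ℝ) ≤ 2 * s⁻¹ ^ (8 * M) := by
      have h4 : (2 * s⁻¹ ^ (8 * M)) * s ^ (8 * M) = 2 := by
        rw [mul_assoc, ← mul_pow, inv_mul_cancel₀ hs0.ne', one_pow, mul_one]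
      refine le_of_mul_le_mul_right (a := s ^ (8 * M)) ?_ (by positivity)
      rw [h4]
      exact hn1
    refine h3.trans ?_
    have := Real.add_one_le_exp (1 : ℝ)
    gcongr
    linarith
  have h5 : (1 - (s ^ 6) ^ M) ^ (n - M) ≤ Real.exp (-((s⁻¹ ^ 2) ^ M - M)) := by
    calc (1 - (s ^ 6) ^ M) ^ (n - M) ≤ (Real.exp (-(s ^ 6) ^ M)) ^ (n - M) := by
          refine pow_le_pow_left₀ (by linarith) ?_ _
          have := Real.add_one_le_exp (-(s ^ 6) ^ M)
          linarith
      _ = Real.exp (-((s ^ 6) ^ M * (n - M))) := by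
          rw [← Real.exp_nat_mul, Nat.cast_sub hM]
          congr 1
          ring
      _ ≤ _ := by
          refine Real.exp_le_exp.2 (neg_le_neg ?_)
          have h6 : (s⁻¹ ^ 2) ^ M ≤ (s ^ 6) ^ M * n := by
            have h7 : (s⁻¹ ^ 2) ^ M * (s ^ 2) ^ M = 1 := by
              rw [← mul_pow, ← mul_pow, inv_mul_cancel₀ hs0.ne', one_pow, one_pow]
            refine le_of_mul_le_mul_right (a := (s ^ 2) ^ M) ?_ (by positivity)
            rw [h7]
            calc 1 ≤ n * s ^ (8 * M) := hn2
              _ = _ := by ring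
          nlinarith
  calc (n : ℝ) ^ M * (1 - (s ^ 6) ^ M) ^ (n - M)
      ≤ (Real.exp (1 + 8 * M * Real.log s⁻¹)) ^ M * Real.exp (-((s⁻¹ ^ 2) ^ M - M)) := by
        refine mul_le_mul (pow_le_pow_left₀ (Nat.cast_nonneg _) h1 _) h5
          (pow_nonneg (by linarith) _) (by positivity)
    _ = Real.exp (M * (1 + 8 * M * Real.log s⁻¹) + -((s⁻¹ ^ 2) ^ M - M)) := by
        rw [← Real.exp_nat_mul, ← Real.exp_add]
    _ ≤ _ := by
        refine Real.exp_le_exp.2 ?_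
        nlinarith

/-- A dominating copy of `W_b` with `b ≤ a` is a small dominating set, and a copy of `W_b` with `b >
a` contains a copy of `W_(a+1)`; both are unlikely. -/
theorem dominatingCopyProb_le (hp1 : p < 1) (hs0 : 0 < s) (hs1 : s < 1)
    (hs : s ^ 6 = 1 - p) (a : ℕ+) (ha : orderW a ≤ ⌈s⁻¹ ^ (8 * orderW a)⌉₊) :
    dominatingCopyProb p ⌈s⁻¹ ^ (8 * orderW a)⌉₊ ≤
      Real.exp ((3 + 8 * Real.log s⁻¹) * (orderW a : ℝ) ^ 2 - (s⁻¹ ^ 2) ^ orderW a) +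
        2 * s⁻¹ ^ 15 * s ^ orderW a := by
  classical
  have hsub : {G : SimpleGraph (Fin ⌈s⁻¹ ^ (8 * orderW a)⌉₊) |
      ∃ a : ℕ+, HasInducedDominatingCopy (graphW a) G} ⊆
      {G | ∃ T : Finset (Fin ⌈s⁻¹ ^ (8 * orderW a)⌉₊), T.Nonempty ∧ T.card ≤ orderW a ∧
        ∀ v, v ∉ T → ∃ u ∈ T, G.Adj v u} ∪ {G | Nonempty (graphW (a + 1) ↪g G)} := by
    rintro G ⟨b, f, hf⟩
    rcases le_or_gt b a with hba | hab
    · left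
      have := Fintype.ofFinite (Fin (b : ℕ) ⊕ {w : List (Fin 4) // w.length < (b : ℕ)})
      refine ⟨Finset.univ.image f, ⟨f (.inl ⟨0, b.pos⟩), by simp⟩, ?_, ?_⟩
      · rw [Finset.card_image_of_injective _ f.injective, Finset.card_univ,
          ← Nat.card_eq_fintype_card, card_vertices_graphW]
        exact orderW_mono hba
      · intro v hv
        obtain ⟨u, hu⟩ := hf v (by simpa using hv)
        exact ⟨f u, Finset.mem_image_of_mem _ (Finset.mem_univ _), hu⟩
    · right
      exact ⟨f.comp (graphWEmbedding (PNat.add_one_le_iff.2 hab))⟩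
  refine (measureReal_mono hsub).trans ((measureReal_union_le _ _).trans (add_le_add ?_ ?_))
  · refine (measureReal_exists_dominating_le (by simpa using ha)).trans ?_
    rw [Fintype.card_fin, ← hs]
    exact pow_mul_one_sub_pow_le hs0 hs1 ha
  · exact measureReal_exists_graphW_le hp1 hs0 hs1 hs a

theorem tendsto_orderW_succPNat : Tendsto (fun k : ℕ => orderW (k.succPNat : ℕ)) atTop atTop := by
  refine tendsto_atTop_mono (fun k => ?_) tendsto_id
  have := le_orderW (k.succPNat : ℕ)
  rw [Nat.succPNat_coe] at this ⊢
  exact (Nat.le_succ k).trans this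

theorem tendsto_ceil_inv_pow (hs0 : 0 < s) (hs1 : s < 1) {c : ℕ} (hc : c ≠ 0) :
    Tendsto (fun N : ℕ => ⌈s⁻¹ ^ (c * N)⌉₊) atTop atTop := by
  refine tendsto_nat_ceil_atTop.comp ?_
  simp only [pow_mul]
  exact tendsto_pow_atTop_atTop_of_one_lt (one_lt_pow₀ ((one_lt_inv₀ hs0).2 hs1) hc)

theorem not_converges_dominatingCopyProb (hp0 : 0 < p) (hp1 : p < 1) :
    ¬ Converges (dominatingCopyProb p) := by
  have hp0' : (0 : ℝ) < p := hp0
  have hp1' : (p : ℝ) < 1 := hp1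
  -- A sixth root makes all exponents integers: `1 - p = s ^ 6` and `√(1 - p) = s ^ 3`.
  obtain ⟨s, hs0, hs1, hs⟩ : ∃ s : ℝ, 0 < s ∧ s < 1 ∧ s ^ 6 = 1 - p := by
    have hq : (0 : ℝ) < 1 - p := by linarith
    refine ⟨(1 - p : ℝ) ^ ((6 : ℕ) : ℝ)⁻¹, Real.rpow_pos_of_pos hq _,
      Real.rpow_lt_one hq.le (by linarith) (by positivity),
      Real.rpow_inv_natCast_pow hq.le (by norm_num)⟩
  have habs : |s| < 1 := by rwa [abs_of_pos hs0]
  have ts := tendsto_pow_atTop_nhds_zero_of_lt_one hs0.le hs1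
  have ts2 := tendsto_pow_const_mul_const_pow_of_abs_lt_one 2 habs
  have ts1 := tendsto_pow_const_mul_const_pow_of_abs_lt_one 1 habs
  rintro ⟨L, hL⟩
  have lower : 1 ≤ L := by
    have h1 : Tendsto (fun N : ℕ => 1 - 4 * s ^ N -
        (1 + ((p : ℝ) ^ 2)⁻¹) * ((N : ℝ) ^ 2 * s ^ N)) atTop (nhds 1) := by
      have := ((ts.const_mul 4).const_sub 1).sub (ts2.const_mul (1 + ((p : ℝ) ^ 2)⁻¹))
      simpa using this
    refine le_of_tendsto_of_tendsto (h1.comp tendsto_orderW_succPNat)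
      (hL.comp ((tendsto_ceil_inv_pow hs0 hs1 (c := 4) (by norm_num)).comp
        tendsto_orderW_succPNat)) (Eventually.of_forall fun k => ?_)
    exact le_dominatingCopyProb hp0 hp1 hs0 hs1 hs k.succPNat
  have upper : L ≤ 0 := by
    have ht : (1 : ℝ) < s⁻¹ ^ 2 := one_lt_pow₀ ((one_lt_inv₀ hs0).2 hs1) (by norm_num)
    have h1 : Tendsto (fun N : ℕ => Real.exp ((3 + 8 * Real.log s⁻¹) * (N : ℝ) ^ 2 -
        (s⁻¹ ^ 2) ^ N) + 2 * s⁻¹ ^ 15 * s ^ N) atTop (nhds 0) := by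
      -- Factoring out the exponential exhibits the exponent as a quantity tending to infinity times
      -- one tending to `-1`.
      have h2 : Tendsto (fun N : ℕ => (s⁻¹ ^ 2) ^ N *
          ((3 + 8 * Real.log s⁻¹) * ((N : ℝ) ^ 2 / (s⁻¹ ^ 2) ^ N) - 1)) atTop atBot := by
        refine Tendsto.atTop_mul_neg (C := -1) (by norm_num)
          (tendsto_pow_atTop_atTop_of_one_lt ht) ?_
        have := ((tendsto_pow_const_div_const_pow_of_one_lt 2 ht).const_mul
          (3 + 8 * Real.log s⁻¹)).sub_const 1
        simpa using this
      have h3 : Tendsto (fun N : ℕ => (3 + 8 * Real.log s⁻¹) * (N : ℝ) ^ 2 -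
          (s⁻¹ ^ 2) ^ N) atTop atBot := by
        refine h2.congr fun N => ?_
        have : (s⁻¹ ^ 2) ^ N ≠ 0 := by positivity
        field_simp
      have := (Real.tendsto_exp_atBot.comp h3).add (ts.const_mul (2 * s⁻¹ ^ 15))
      simpa using this
    have h4 : ∀ᶠ N : ℕ in atTop, N ≤ ⌈s⁻¹ ^ (8 * N)⌉₊ := by
      filter_upwards [ts1.eventually (gt_mem_nhds (zero_lt_one))] with N hN
      rw [pow_one] at hN
      have h5 := one_le_ceil_inv_pow_mul hs0 (8 * N)
      have h6 : s ^ (8 * N) ≤ s ^ N := pow_le_pow_of_le_one hs0.le hs1.le (by omega)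
      have h7 : (0 : ℝ) < s ^ N := by positivity
      have h8 : (0 : ℝ) ≤ ⌈s⁻¹ ^ (8 * N)⌉₊ := Nat.cast_nonneg _
      have h9 : (N : ℝ) * s ^ N ≤ ⌈s⁻¹ ^ (8 * N)⌉₊ * s ^ N := by
        have := mul_le_mul_of_nonneg_left h6 h8
        linarith
      exact_mod_cast le_of_mul_le_mul_right h9 h7
    refine le_of_tendsto_of_tendsto (hL.comp
      ((tendsto_ceil_inv_pow hs0 hs1 (c := 8) (by norm_num)).comp tendsto_orderW_succPNat))
      (h1.comp tendsto_orderW_succPNat) ?_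
    filter_upwards [tendsto_orderW_succPNat.eventually h4] with k hk
    exact dominatingCopyProb_le hp1 hs0 hs1 hs k.succPNat hk
  linarith

theorem not_converges_prob {m k : ℕ} {φ : EMSOSentence m k} (hp0 : 0 < p) (hp1 : p < 1)
    (hφ : ∀ (V : Type) [Finite V] [Nonempty V] (G : SimpleGraph V),
      φ.Models G ↔ ∃ a : ℕ+, HasInducedDominatingCopy (graphW a) G) :
    ¬ Converges (prob φ p) := by
  rintro ⟨L, hL⟩
  refine not_converges_dominatingCopyProb hp0 hp1 ⟨L, hL.congr' ?_⟩
  -- The equivalence holds for non-empty graphs only, so `n = 0` is excluded, which does not affect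
  -- the limit.
  filter_upwards [eventually_gt_atTop 0] with n hn
  have : Nonempty (Fin n) := ⟨⟨0, hn⟩⟩
  simp only [prob, dominatingCopyProb, hφ]

end Asymptotics
end EMSOGraph

theorem theorem3 (p : unitInterval) (hp0 : 0 < p) (hp1 : p < 1) :
    (∃ (k : ℕ) (φ₁ : EMSOGraph.EMSOSentence 1 k),
      (∀ (V : Type) [Finite V] [Nonempty V] (G : SimpleGraph V),
        φ₁.Models G ↔ ∃ a : ℕ+, EMSOGraph.HasInducedDominatingCopy (EMSOGraph.graphW a) G) ∧
      ¬ EMSOGraph.Converges (EMSOGraph.prob φ₁ p)) ∧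
    (∃ (m : ℕ) (φ₂ : EMSOGraph.EMSOSentence m 3),
      ¬ EMSOGraph.Converges (EMSOGraph.prob φ₂ p)) := by
  exact ⟨⟨19, EMSOGraph.oneSetFormula.toSentence, fun _ _ _ G => EMSOGraph.oneSet_models_iff G,
      EMSOGraph.not_converges_prob hp0 hp1 fun _ _ _ G => EMSOGraph.oneSet_models_iff G⟩,
    9, EMSOGraph.threeVariableFormula.toSentence,
    EMSOGraph.not_converges_prob hp0 hp1 fun _ _ _ G => EMSOGraph.threeVariables_models_iff G⟩
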